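/- Let $N\ge1$ and $p>1$ be fixed, and put $p_F:=1+\frac2N$. For $\alpha\in(0,1)$ and a nonnegative Radon measure $\mu$ on $\mathbf R^N$ consider the Cauchy problem $$\partial_t^\alpha u-\Delta u=u^p\ \text{ in }(0,T)\times\mathbf R^N,\qquad u(0)=\mu, \tag{1}$$ where $\partial_t^\alpha$ is the Caputo derivative. With $G(t,x)=(4\pi t)^{-N/2}e^{-|x|^2/(4t)}$, $[e^{t\Delta}\mu](x)=\int_{\mathbf R^N} G(t,x-y)\,d\mu(y)$ (a function $\phi\ge0$ being identified with the measure $\phi\,dx$) and the probability density $$h_\alpha(\theta)=\sum_{n=0}^\infty\frac{(-\theta)^n}{n!\,\Gamma(1-\alpha-\alpha n)}\quad(\theta>0,\ 1/\Gamma:=0\text{ at the poles of }\Gamma),$$ put $P_\alpha(t)=\int_0^\infty h_\alpha(\theta)e^{t^\alpha\theta\Delta}\,d\theta$ and $S_\alpha(t)=\int_0^\infty\theta h_\alpha(\theta)e^{t^\alpha\theta\Delta}\,d\theta$. For $0<T<\infty$, a nonnegative measurable function $u$ on $(0,T]\times\mathbf R^N$ is a solution of (1) in $[0,T]\times\mathbf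 R^N$ if $$\infty>u(t,x)=[P_\alpha(t)\mu](x)+\alpha\int_0^t(t-s)^{\alpha-1}[S_\alpha(t-s)u(s)^p](x)\,ds$$ for almost all $t\in(0,T]$ and $x\in\mathbf R^N$. Problem (1) possesses a local-in-time solution if it has a solution in $[0,T]\times\mathbf R^N$ for some $T>0$. The minimal solution in $[0,T]\times\mathbf R^N$ is a solution that is almost everywhere $\le$ every solution in $[0,T]\times\mathbf R^N$, and the life span $T_\alpha[\mu]\in[0,\infty]$ is the supremum of all $T>0$ such that the minimal solution in $[0,T]\times\mathbf R^N$ exists. Let $\mu=\kappa\delta_N$, where $\kappa>0$ and $\delta_N$ is the Dirac measure at the origin of $\mathbf R^N$. Then: (i) If $p<p_F$, then for every $\alpha\in(0,1)$ and every $\kappa>0$ problem (1) possesses a local-in-time solution. Furthermore $$T_\alpha[\kappa\delta_N]\simeq\kappa^{-\frac{2(p-1)}{\alpha(2-N(p-1))}},$$ that is, there are $0<c(\alpha)<C(\alpha)$, $\alpha\in(0,1)$, independent of $\kappa$, with $$c(\alpha)\,\kappa^{-\frac{2(p-1)}{\alpha(2-N(p-1))}}\le T_\alpha[\kappa\delta_N]\le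 C(\alpha)\,\kappa^{-\frac{2(p-1)}{\alpha(2-N(p-1))}}\quad\text{for all }\kappa>0,\ \alpha\in(0,1),$$ such that $\limsup_{\alpha\to1-0}c(\alpha)\in(0,\infty)$ and $\limsup_{\alpha\to1-0}C(\alpha)\in(0,\infty)$. (ii) If $p=p_F$, then for every $\alpha\in(0,1)$ there exists $\kappa(\alpha)>0$ such that problem (1) possesses a local-in-time solution if $0<\kappa<\kappa(\alpha)$, and possesses no local-in-time solution if $\kappa>\kappa(\alpha)$. (iii) If $p>p_F$, then for every $\alpha\in(0,1)$ and every $\kappa>0$ problem (1) possesses no local-in-time solution. -/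

import Mathlib

open MeasureTheory Set Filter Topology
open scoped ENNReal

noncomputable section

namespace TimeFractionalFujita

/-- The space `ℝ^N` with its Euclidean norm. -/
abbrev Space (N : ℕ) : Type := EuclideanSpace ℝ (Fin N)

/-- The Fujita exponent `p_F = 1 + 2 / N`. -/
def fujitaExponent (N : ℕ) : ℝ := 1 + 2 / (N : ℝ)

/-- The Gauss kernel `G(t, x) = (4 π t)^{-N/2} exp(-|x|² / (4 t))`. -/
def heatKernel (N : ℕ) (t : ℝ) (x : Space N) : ℝ :=
  1 / (4 * Real.pi * t) ^ ((N : ℝ) / 2) * Real.exp (-‖x‖ ^ 2 / (4 * t))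

/-- `(e^{tΔ} μ)(x) = ∫ G(t, x - y) dμ(y)`, with values in `[0, ∞]`, for a nonnegative measure `μ`. -/
def heatFlow {N : ℕ} (t : ℝ) (μ : Measure (Space N)) (x : Space N) : ℝ≥0∞ :=
  ∫⁻ y, ENNReal.ofReal (heatKernel N t (x - y)) ∂μ

/-- The probability density `h_α` on `(0, ∞)` of the subordination formula, that is the
Wright-type (Mainardi) function `h_α(θ) = ∑_{n ≥ 0} (-θ)^n / (n! Γ(1 - α - α n))`.
It is the density with `∫_0^∞ h_α(θ) e^{zθ} dθ = E_{α,1}(z)`, the Mittag-Leffler function.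
As `Real.Gamma` vanishes at the poles of `Γ`, the terms with `1 - α - α n ∈ {0, -1, -2, …}` are `0`,
in agreement with `1 / Γ = 0` there. -/
def wrightDensity (α θ : ℝ) : ℝ :=
  ∑' n : ℕ, (-θ) ^ n / ((n.factorial : ℝ) * Real.Gamma (1 - α - α * n))

/-- `P_α(t) μ = ∫_0^∞ h_α(θ) e^{t^α θ Δ} μ dθ`. -/
def solutionOpP {N : ℕ} (α t : ℝ) (μ : Measure (Space N)) (x : Space N) : ℝ≥0∞ :=
  ∫⁻ θ in Ioi (0 : ℝ), ENNReal.ofReal (wrightDensity α θ) * heatFlow (t ^ α * θ) μ x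

/-- `S_α(t) μ = ∫_0^∞ θ h_α(θ) e^{t^α θ Δ} μ dθ`. -/
def solutionOpS {N : ℕ} (α t : ℝ) (μ : Measure (Space N)) (x : Space N) : ℝ≥0∞ :=
  ∫⁻ θ in Ioi (0 : ℝ), ENNReal.ofReal (θ * wrightDensity α θ) * heatFlow (t ^ α * θ) μ x

/-- The right-hand side of the integral equation,
`[P_α(t) μ](x) + α ∫_0^t (t - s)^{α-1} [S_α(t - s) u(s)^p](x) ds`;
the function `u(s)^p` is identified with the measure `u(s)^p dx`. -/
def duhamel {N : ℕ} (α p : ℝ) (μ : Measure (Space N)) (u : ℝ → Space N → ℝ≥0∞)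
    (t : ℝ) (x : Space N) : ℝ≥0∞ :=
  solutionOpP α t μ x +
    ENNReal.ofReal α * ∫⁻ s in Ioo 0 t, ENNReal.ofReal ((t - s) ^ (α - 1)) *
      solutionOpS α (t - s) (volume.withDensity fun y => u s y ^ p) x

/-- `u` is a (nonnegative, Lebesgue measurable) solution in `[0, T] × ℝ^N` of
`∂_t^α u - Δ u = u^p`, `u(0) = μ`: the integral equation holds, with finite values, at almost every
point of `(0, T] × ℝ^N`. Only the values of `u` on `(0, T] × ℝ^N` matter. -/
structure IsSolution {N : ℕ} (α p : ℝ) (μ : Measure (Space N)) (T : ℝ)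
    (u : ℝ → Space N → ℝ≥0∞) : Prop where
  aemeasurable : AEMeasurable (fun z : ℝ × Space N => u z.1 z.2)
    (volume.restrict (Ioc 0 T ×ˢ univ))
  eq_duhamel : ∀ᵐ z : ℝ × Space N ∂(volume.restrict (Ioc 0 T ×ˢ univ)),
    u z.1 z.2 < ∞ ∧ u z.1 z.2 = duhamel α p μ u z.1 z.2

/-- The problem possesses a local-in-time solution. -/
def LocallySolvable {N : ℕ} (α p : ℝ) (μ : Measure (Space N)) : Prop :=
  ∃ T : ℝ, 0 < T ∧ ∃ u : ℝ → Space N → ℝ≥0∞, IsSolution α p μ T u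

/-- The minimal solution in `[0, T] × ℝ^N`: a solution that lies below every solution there. -/
def IsMinimalSolution {N : ℕ} (α p : ℝ) (μ : Measure (Space N)) (T : ℝ)
    (u : ℝ → Space N → ℝ≥0∞) : Prop :=
  IsSolution α p μ T u ∧ ∀ v : ℝ → Space N → ℝ≥0∞, IsSolution α p μ T v →
    ∀ᵐ z : ℝ × Space N ∂(volume.restrict (Ioc 0 T ×ˢ univ)), u z.1 z.2 ≤ v z.1 z.2

/-- The life span `T_α[μ] ∈ [0, ∞]`: the supremum of the `T > 0` such that the minimal solution exists
in `[0, T] × ℝ^N`. -/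
def lifespan {N : ℕ} (α p : ℝ) (μ : Measure (Space N)) : ℝ≥0∞ :=
  ⨆ (T : ℝ) (_ : 0 < T ∧ ∃ u : ℝ → Space N → ℝ≥0∞, IsMinimalSolution α p μ T u), ENNReal.ofReal T

/-- The measure `κ δ_N`. -/
def diracMass (N : ℕ) (κ : ℝ) : Measure (Space N) :=
  ENNReal.ofReal κ • Measure.dirac 0

/-- `A ≃ B` for `[0, ∞]`-valued `A` and real `B`, both depending on `α ∈ (0, 1)` and `κ > 0`:
there are `0 < c(α) < C(α)` with `c(α) B ≤ A ≤ C(α) B` for all `κ > 0`, and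
`limsup_{α → 1-0} c(α)` and `limsup_{α → 1-0} C(α)` lie in `(0, ∞)`. -/
def Equivalent (A : ℝ → ℝ → ℝ≥0∞) (B : ℝ → ℝ → ℝ) : Prop :=
  ∃ c C : ℝ → ℝ,
    (∀ α ∈ Ioo (0 : ℝ) 1, 0 < c α ∧ c α < C α ∧ ∀ κ : ℝ, 0 < κ →
      ENNReal.ofReal (c α * B α κ) ≤ A α κ ∧ A α κ ≤ ENNReal.ofReal (C α * B α κ)) ∧
    limsup (fun α => ENNReal.ofReal (c α)) (𝓝[<] 1) ∈ Ioo 0 ∞ ∧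
    limsup (fun α => ENNReal.ofReal (C α)) (𝓝[<] 1) ∈ Ioo 0 ∞

end TimeFractionalFujita

end

/-!
For `μ ≥ 0` the limit `u` of the increasing Picard iterates of the integral equation lies below
every solution, so solvability in `[0, T]` amounts to finiteness of `u` almost everywhere. By
scaling, this is a question about the size of `κ ^ (p - 1) * T ^ (α * (1 - N (p - 1) / 2))` alone.

*Sufficiency.* Minkowski's inequality carries the `L^p` decay of the heat kernel over to `P_α` and
`S_α`, so for small values of this quantity the ball `‖u(t)‖_p ≤ C κ t ^ (-α γ)`,
`γ = N (p - 1) / (2 p)`, is invariant under the Picard iteration.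

*Necessity.* Let `G` be a Gaussian of variance comparable to `T ^ α`. For `t ≤ T` the operators
`P_α(t)` and `S_α(t)` keep a fraction of `∫ G dμ` that does not depend on `α`, because the mass of
`h_α` on a fixed compact subset of `(0, ∞)` is bounded below. Jensen's inequality turns the integral
equation into `I(t) ≥ (c ∫ G dμ + c α T ^ (α - 1) ∫_0^t I) ^ p` for `I(t) = ∫ G u(t) ^ p`, which
forces `I = ∞` on `(T / 2, T]`, and then `u = ∞` near `T`, as soon as the quantity above is large.

The moments of `h_α` come from its Mellin transform, computed from a Hankel type integral along a
ray on which `Re z < 0 < Re z ^ α`. Its positivity follows by approximating `θ h_α(θ)`, up to the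
factor `α`, by coefficients of powers of `1 - (1 - z) ^ α`, a power series with nonnegative
coefficients.
-/

namespace TimeFractionalFujita

/-! ### Ratios of Gamma functions -/

section Gamma

lemma one_le_Gamma {x : ℝ} (h0 : 0 < x) (h1 : x ≤ 1) : 1 ≤ Real.Gamma x := by
  simpa using Real.Gamma_strictAntiOn_Ioc.antitoneOn ⟨h0, h1⟩ ⟨one_pos, le_rfl⟩ h1

lemma Gamma_le_one {x : ℝ} (h1 : 1 ≤ x) (h2 : x ≤ 2) : Real.Gamma x ≤ 1 := by
  simpa [Real.Gamma_two] using
    Real.convexOn_Gamma.le_max_of_mem_Icc (mem_Ioi.2 one_pos) (mem_Ioi.2 two_pos) ⟨h1, h2⟩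

lemma half_le_Gamma {x : ℝ} (h1 : 1 ≤ x) (h2 : x ≤ 2) : 1 / 2 ≤ Real.Gamma x := by
  have h : Real.Gamma 2 ≤ Real.Gamma (x + 1) :=
    Real.Gamma_strictMonoOn_Ici.monotoneOn self_mem_Ici (mem_Ici.2 (by linarith)) (by linarith)
  rw [Real.Gamma_two, Real.Gamma_add_one (by linarith)] at h
  nlinarith [Real.Gamma_pos_of_pos (by linarith : 0 < x)]

lemma Gamma_add_le {s r : ℝ} (hs : 0 < s) (h0 : 0 < r) (h1 : r < 1) :
    Real.Gamma (s + r) ≤ Real.Gamma s * s ^ r := by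
  have h := Real.Gamma_mul_add_mul_le_rpow_Gamma_mul_rpow_Gamma hs (by linarith : 0 < s + 1)
    (by linarith : 0 < 1 - r) h0 (by ring)
  have hG := Real.Gamma_pos_of_pos hs
  rwa [show (1 - r) * s + r * (s + 1) = s + r by ring, Real.Gamma_add_one hs.ne',
    Real.mul_rpow hs.le hG.le, mul_left_comm, ← Real.rpow_add hG, sub_add_cancel, Real.rpow_one,
    mul_comm] at h

lemma Gamma_add_one_mul_rpow_le {x r : ℝ} (hx : 0 < x) (hr : 0 ≤ r) :
    Real.Gamma (x + 1) * x ^ r ≤ Real.Gamma (x + 1 + r) := by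
  rcases hr.eq_or_lt with rfl | hr
  · simp
  have hΓ : 0 < Real.Gamma x := Real.Gamma_pos_of_pos hx
  have hΓr : 0 < Real.Gamma (x + 1 + r) := Real.Gamma_pos_of_pos (by positivity)
  have hconv : Real.Gamma (x + 1) ≤
      Real.Gamma x ^ (r / (1 + r)) * Real.Gamma (x + 1 + r) ^ (1 / (1 + r)) := by
    convert! Real.Gamma_mul_add_mul_le_rpow_Gamma_mul_rpow_Gamma hx
      (by positivity : 0 < x + 1 + r) (by positivity : 0 < r / (1 + r))
      (by positivity : 0 < 1 / (1 + r)) (by field_simp; ring) using 2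
    field_simp
    ring
  have hpow : Real.Gamma (x + 1) ^ (1 + r) ≤ Real.Gamma x ^ r * Real.Gamma (x + 1 + r) := by
    calc Real.Gamma (x + 1) ^ (1 + r)
        ≤ (Real.Gamma x ^ (r / (1 + r)) * Real.Gamma (x + 1 + r) ^ (1 / (1 + r))) ^ (1 + r) := by
          have := (Real.Gamma_pos_of_pos (by positivity : 0 < x + 1)).le
          gcongr
      _ = Real.Gamma x ^ r * Real.Gamma (x + 1 + r) := by
          rw [Real.mul_rpow (by positivity) (by positivity), ← Real.rpow_mul hΓ.le,
            ← Real.rpow_mul hΓr.le, div_mul_cancel₀ _ (by positivity),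
            div_mul_cancel₀ _ (by positivity), Real.rpow_one]
  rw [Real.Gamma_add_one hx.ne', Real.rpow_add (by positivity), Real.rpow_one,
    Real.mul_rpow hx.le hΓ.le] at hpow
  rw [Real.Gamma_add_one hx.ne']
  refine le_of_mul_le_mul_left ?_ (Real.rpow_pos_of_pos hΓ r)
  linarith

lemma inv_Gamma_one_sub {x : ℝ} (hx : 0 < x) :
    (Real.Gamma (1 - x))⁻¹ = Real.Gamma x * Real.sin (Real.pi * x) / Real.pi := by
  have h := Real.Gamma_mul_Gamma_one_sub x
  have hG := (Real.Gamma_pos_of_pos hx).ne'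
  rw [← inv_inj, mul_inv, inv_div] at h
  rw [mul_div_assoc, ← h, mul_inv_cancel_left₀ hG]

lemma abs_inv_Gamma_one_sub_le {x : ℝ} (hx : 0 < x) :
    |(Real.Gamma (1 - x))⁻¹| ≤ Real.Gamma x := by
  have hG := Real.Gamma_pos_of_pos hx
  rw [inv_Gamma_one_sub hx, abs_div, abs_mul, abs_of_pos hG, abs_of_pos Real.pi_pos,
    div_le_iff₀ Real.pi_pos]
  gcongr
  exact (Real.abs_sin_le_one _).trans (by linarith [Real.pi_gt_three])

lemma summable_pow_div_factorial_mul_Gamma {α a x : ℝ} (h0 : 0 < α) (h1 : α < 1) (ha : 0 < a)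
    (hx : 0 ≤ x) : Summable fun k : ℕ => x ^ k / k.factorial * Real.Gamma (a + α * k) := by
  refine summable_of_ratio_norm_eventually_le (r := 1 / 2) (by norm_num) ?_
  have hratio : Tendsto (fun k : ℕ => x * (a + 1) ^ α * ((k : ℝ) + 1) ^ (-(1 - α))) atTop
      (𝓝 0) := by
    have := (tendsto_rpow_neg_atTop (by linarith : 0 < 1 - α)).comp
      (tendsto_atTop_add_const_right atTop (1 : ℝ) tendsto_natCast_atTop_atTop)
    simpa using this.const_mul (x * (a + 1) ^ α)
  filter_upwards [hratio.eventually (gt_mem_nhds (by norm_num : (0 : ℝ) < 1 / 2))] with k hk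
  have hs : 0 < a + α * k := by positivity
  have hG := Real.Gamma_pos_of_pos hs
  have hG' := Real.Gamma_pos_of_pos (by positivity : 0 < a + α * ((k + 1 : ℕ) : ℝ))
  have hstep : Real.Gamma (a + α * ((k + 1 : ℕ) : ℝ)) ≤
      Real.Gamma (a + α * k) * ((a + 1) * (k + 1)) ^ α := by
    rw [show a + α * ((k + 1 : ℕ) : ℝ) = a + α * k + α by push_cast; ring]
    refine (Gamma_add_le hs h0 h1).trans ?_
    gcongr
    nlinarith [(Nat.cast_nonneg k : (0 : ℝ) ≤ k)]
  rw [neg_sub, Real.rpow_sub_one (by positivity)] at hk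
  rw [Real.norm_of_nonneg (by positivity), Real.norm_of_nonneg (by positivity)]
  calc x ^ (k + 1) / (k + 1).factorial * Real.Gamma (a + α * ((k + 1 : ℕ) : ℝ))
      ≤ x ^ (k + 1) / (k + 1).factorial * (Real.Gamma (a + α * k) * ((a + 1) * (k + 1)) ^ α) := by
        gcongr
    _ = x * (a + 1) ^ α * ((k + 1 : ℝ) ^ α / (k + 1)) *
        (x ^ k / k.factorial * Real.Gamma (a + α * k)) := by
        rw [Real.mul_rpow (by positivity) (by positivity), Nat.factorial_succ]
        push_cast
        field_simp
        ring
    _ ≤ _ := by gcongr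

/-- At a pole of `Γ` in the denominator both sides are `0`, since then `r < n` is a natural number
and one factor of the product vanishes. -/
lemma prod_range_natCast_sub {r : ℝ} {n : ℕ} (hr : r < n) :
    ∏ i ∈ Finset.range n, ((i : ℝ) - r) = Real.Gamma (n - r) / Real.Gamma (-r) := by
  by_cases hk : ∃ k : ℕ, r = k
  · obtain ⟨k, rfl⟩ := hk
    rw [Real.Gamma_neg_nat_eq_zero, div_zero]
    exact Finset.prod_eq_zero (Finset.mem_range.2 (by exact_mod_cast hr)) (sub_self _)
  push Not at hk
  rw [eq_div_iff (Real.Gamma_ne_zero fun m h => hk m (neg_injective h))]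
  clear hr
  induction n with
  | zero => simp
  | succ n ih =>
    rw [Finset.prod_range_succ, mul_right_comm, ih, Nat.cast_succ, add_sub_right_comm,
      Real.Gamma_add_one (sub_ne_zero.2 (hk n).symm), mul_comm]

lemma abs_prod_range_natCast_sub_mul_rpow_le {r : ℝ} (hr : 0 ≤ r) {m : ℕ} (hm : 0 < m)
    (hrm : 2 * r ≤ m) :
    |∏ i ∈ Finset.range (m + 1), ((i : ℝ) - r)| * (m : ℝ) ^ r / m.factorial ≤
      2 ^ r * Real.Gamma (1 + r) := by
  have hm' : (0 : ℝ) < m := by exact_mod_cast hm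
  have hmr : 0 < m - r := by linarith
  have hΓ : 0 < Real.Gamma (m - r + 1) := Real.Gamma_pos_of_pos (by linarith)
  have hinv : |(Real.Gamma (-r))⁻¹| ≤ Real.Gamma (1 + r) := by
    simpa using abs_inv_Gamma_one_sub_le (by linarith : 0 < 1 + r)
  have hprod : |∏ i ∈ Finset.range (m + 1), ((i : ℝ) - r)| ≤
      Real.Gamma (m - r + 1) * Real.Gamma (1 + r) := by
    rw [prod_range_natCast_sub (by push_cast; linarith), div_eq_mul_inv, abs_mul, Nat.cast_succ,
      add_sub_right_comm, abs_of_pos hΓ]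
    gcongr
  have hpow : (m : ℝ) ^ r ≤ 2 ^ r * (m - r) ^ r := by
    rw [← Real.mul_rpow two_pos.le hmr.le]
    gcongr
    linarith
  have hfact : Real.Gamma (m - r + 1) * (m - r) ^ r ≤ m.factorial := by
    refine (Gamma_add_one_mul_rpow_le hmr hr).trans_eq ?_
    rw [show (m : ℝ) - r + 1 + r = m + 1 by ring, Real.Gamma_nat_eq_factorial]
  have := Real.Gamma_pos_of_pos (by linarith : 0 < 1 + r)
  rw [div_le_iff₀ (by positivity)]
  calc _ ≤ (Real.Gamma (m - r + 1) * Real.Gamma (1 + r)) * (2 ^ r * (m - r) ^ r) := by gcongr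
    _ = 2 ^ r * Real.Gamma (1 + r) * (Real.Gamma (m - r + 1) * (m - r) ^ r) := by ring
    _ ≤ _ := by gcongr

lemma tendsto_prod_range_natCast_sub_mul_rpow (r : ℝ) :
    Tendsto (fun m : ℕ => (∏ i ∈ Finset.range (m + 1), ((i : ℝ) - r)) * (m : ℝ) ^ r / m.factorial)
      atTop (𝓝 (Real.Gamma (-r))⁻¹) := by
  by_cases hr : ∃ k : ℕ, r = k
  · obtain ⟨k, rfl⟩ := hr
    rw [Real.Gamma_neg_nat_eq_zero, inv_zero]
    refine tendsto_const_nhds.congr' ?_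
    filter_upwards [eventually_ge_atTop k] with m hm
    rw [Finset.prod_eq_zero (Finset.mem_range.2 (Nat.lt_succ_of_le hm)) (sub_self _), zero_mul,
      zero_div]
  push Not at hr
  have hΓ : Real.Gamma (-r) ≠ 0 := Real.Gamma_ne_zero fun m h => hr m (neg_injective h)
  refine ((Real.GammaSeq_tendsto_Gamma (-r)).inv₀ hΓ).congr' ?_
  filter_upwards [eventually_gt_atTop 0] with m hm
  have hm' : (0 : ℝ) < m := by exact_mod_cast hm
  simp_rw [Real.GammaSeq, neg_add_eq_sub, Real.rpow_neg hm'.le, inv_div]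
  have := (Real.rpow_pos_of_pos hm' r).ne'
  field_simp

end Gamma

/-! ### Positivity of the Wright function -/

section Positivity

/-- The power series of `(1 - z) ^ r`. Its powers with `r = α` generate the approximations from
which the positivity of `wrightDensity α` is read off. -/
noncomputable def oneSubPow (r : ℝ) : PowerSeries ℝ :=
  PowerSeries.rescale (-1) (PowerSeries.binomialSeries ℝ r)

lemma coeff_oneSubPow (r : ℝ) (j : ℕ) :
    PowerSeries.coeff j (oneSubPow r) =
      (∏ i ∈ Finset.range j, ((i : ℝ) - r)) / j.factorial := by
  rw [oneSubPow, PowerSeries.coeff_rescale, PowerSeries.binomialSeries_coeff,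
    Ring.choose_eq_smul, ← Polynomial.eval₂_smulOneHom_eq_smeval, ← Polynomial.eval_map,
    descPochhammer_map, descPochhammer_eval_eq_prod_range]
  simp_rw [← neg_sub r, Finset.prod_neg, Finset.card_range, smul_eq_mul]
  ring

lemma oneSubPow_add (r s : ℝ) : oneSubPow (r + s) = oneSubPow r * oneSubPow s := by
  rw [oneSubPow, PowerSeries.binomialSeries_add, map_mul, oneSubPow, oneSubPow]

lemma oneSubPow_mul_natCast (r : ℝ) (k : ℕ) : oneSubPow (r * k) = oneSubPow r ^ k := by
  induction k with
  | zero => simp [oneSubPow]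
  | succ k ih => rw [Nat.cast_succ, mul_add_one, oneSubPow_add, ih, pow_succ]

lemma coeff_one_sub_oneSubPow_nonneg {r : ℝ} (h0 : 0 ≤ r) (h1 : r ≤ 1) (j : ℕ) :
    0 ≤ PowerSeries.coeff j (1 - oneSubPow r) := by
  rw [map_sub, PowerSeries.coeff_one, coeff_oneSubPow, sub_nonneg]
  cases j with
  | zero => simp
  | succ j =>
    rw [if_neg j.succ_ne_zero, Finset.prod_range_succ']
    refine div_nonpos_of_nonpos_of_nonneg (mul_nonpos_of_nonneg_of_nonpos
      (Finset.prod_nonneg fun i _ => ?_) (by simpa using h0)) (by positivity)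
    push_cast
    linarith [(Nat.cast_nonneg i : (0 : ℝ) ≤ i)]

lemma coeff_pow_nonneg {f : PowerSeries ℝ} (hf : ∀ j, 0 ≤ PowerSeries.coeff j f) (n j : ℕ) :
    0 ≤ PowerSeries.coeff j (f ^ n) := by
  rw [PowerSeries.coeff_pow]
  exact Finset.sum_nonneg fun _ _ => Finset.prod_nonneg fun _ _ => hf _

lemma sum_choose_mul_coeff_oneSubPow_nonneg {r : ℝ} (h0 : 0 ≤ r) (h1 : r ≤ 1) (n j : ℕ) :
    0 ≤ ∑ k ∈ Finset.range (n + 1),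
      (-1) ^ k * (n.choose k : ℝ) * PowerSeries.coeff j (oneSubPow (r * k)) := by
  have hexpand : (1 - oneSubPow r) ^ n = ∑ k ∈ Finset.range (n + 1),
      PowerSeries.C ((-1) ^ k * (n.choose k : ℝ)) * oneSubPow (r * k) := by
    rw [sub_eq_neg_add, add_pow]
    refine Finset.sum_congr rfl fun k _ => ?_
    rw [oneSubPow_mul_natCast, neg_pow, map_mul, map_pow, map_neg, map_one, map_natCast]
    ring
  have h := coeff_pow_nonneg (coeff_one_sub_oneSubPow_nonneg h0 h1) n j
  rw [hexpand, map_sum] at h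
  simpa only [PowerSeries.coeff_C_mul] using h

lemma tendsto_choose_floor_mul_rpow_div {θ : ℝ} (hθ : 0 < θ) {α : ℝ} (h0 : 0 < α) (k : ℕ) :
    Tendsto (fun m : ℕ => ((⌊θ * (m : ℝ) ^ α⌋₊).choose k : ℝ) / (m : ℝ) ^ (α * k)) atTop
      (𝓝 (θ ^ k / k.factorial)) := by
  have hrpow : Tendsto (fun m : ℕ => (m : ℝ) ^ α) atTop atTop :=
    (tendsto_rpow_atTop h0).comp tendsto_natCast_atTop_atTop
  have hfactor (i : ℕ) :
      Tendsto (fun m : ℕ => ((⌊θ * (m : ℝ) ^ α⌋₊ : ℝ) - i) / (m : ℝ) ^ α) atTop (𝓝 θ) := by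
    simpa [sub_div] using ((tendsto_nat_floor_mul_div_atTop hθ.le).comp hrpow).sub
      (hrpow.const_div_atTop (i : ℝ))
  have hprod := (tendsto_finsetProd (Finset.range k) fun i _ => hfactor i).div_const
    (k.factorial : ℝ)
  rw [Finset.prod_const, Finset.card_range] at hprod
  refine hprod.congr fun m => ?_
  rw [Nat.cast_choose_eq_descPochhammer_div, descPochhammer_eval_eq_prod_range,
    Finset.prod_div_distrib, Finset.prod_const, Finset.card_range,
    Real.rpow_mul_natCast (Nat.cast_nonneg m)]
  ring

lemma eventually_mul_rpow_le_self (c : ℝ) {α : ℝ} (h1 : α < 1) :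
    ∀ᶠ m : ℕ in atTop, c * (m : ℝ) ^ α ≤ m := by
  have h : Tendsto (fun m : ℕ => c * (m : ℝ) ^ (-(1 - α))) atTop (𝓝 0) := by
    simpa using ((tendsto_rpow_neg_atTop (sub_pos.2 h1)).comp
      (tendsto_natCast_atTop_atTop (R := ℝ))).const_mul c
  filter_upwards [h.eventually (gt_mem_nhds (zero_lt_one' ℝ)), eventually_gt_atTop 0] with m hm hm0
  have hm' : (0 : ℝ) < m := by exact_mod_cast hm0
  rw [neg_sub, Real.rpow_sub_one hm'.ne', ← mul_div_assoc, div_lt_one hm'] at hm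
  exact hm.le

/-- The Wright function `∑ (-θ) ^ k / (k! Γ (1 - a - α k))`; `a = α` gives `wrightDensity α`. The
member `a = 1` is `α θ wrightDensity α θ`, and its positivity and moments are easier to reach. -/
noncomputable def wrightSeries (α a θ : ℝ) : ℝ :=
  ∑' k : ℕ, (-θ) ^ k / ((k.factorial : ℝ) * Real.Gamma (1 - a - α * k))

lemma wrightDensity_eq_wrightSeries (α θ : ℝ) : wrightDensity α θ = wrightSeries α α θ := rfl

/-- With `n = ⌊θ m ^ α⌋`, the sum over `k` of these terms is `m + 1` times the coefficient of
`z ^ (m + 1)` in `(1 - (1 - z) ^ α) ^ n`; as `m → ∞` they tend to the terms of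
`wrightSeries α 1 θ`. -/
noncomputable def wrightApprox (α θ : ℝ) (m k : ℕ) : ℝ :=
  (-1) ^ k * ((⌊θ * (m : ℝ) ^ α⌋₊).choose k : ℝ) *
    (∏ i ∈ Finset.range (m + 1), ((i : ℝ) - α * k)) / m.factorial

variable {α a θ : ℝ}

lemma tsum_wrightApprox_nonneg (h0 : 0 ≤ α) (h1 : α ≤ 1) (θ : ℝ) (m : ℕ) :
    0 ≤ ∑' k, wrightApprox α θ m k := by
  have hfin : ∑' k, wrightApprox α θ m k =
      ∑ k ∈ Finset.range (⌊θ * (m : ℝ) ^ α⌋₊ + 1), wrightApprox α θ m k := by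
    refine tsum_eq_sum fun k hk => ?_
    rw [Finset.mem_range, not_lt, Nat.succ_le_iff] at hk
    simp [wrightApprox, Nat.choose_eq_zero_of_lt hk]
  rw [hfin]
  have h := mul_nonneg (by positivity : (0 : ℝ) ≤ m + 1)
    (sum_choose_mul_coeff_oneSubPow_nonneg h0 h1 ⌊θ * (m : ℝ) ^ α⌋₊ (m + 1))
  rw [Finset.mul_sum] at h
  refine h.trans_eq (Finset.sum_congr rfl fun k _ => ?_)
  rw [coeff_oneSubPow, Nat.factorial_succ, wrightApprox]
  push_cast
  field_simp

lemma tendsto_wrightApprox (h0 : 0 < α) (hθ : 0 < θ) (k : ℕ) :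
    Tendsto (fun m => wrightApprox α θ m k) atTop
      (𝓝 ((-θ) ^ k / ((k.factorial : ℝ) * Real.Gamma (1 - 1 - α * k)))) := by
  have h := ((tendsto_choose_floor_mul_rpow_div hθ h0 k).mul
    (tendsto_prod_range_natCast_sub_mul_rpow (α * k))).const_mul ((-1) ^ k)
  rw [sub_self, zero_sub, neg_pow θ, show (-1) ^ k * θ ^ k /
    ((k.factorial : ℝ) * Real.Gamma (-(α * k))) =
      (-1) ^ k * (θ ^ k / k.factorial * (Real.Gamma (-(α * k)))⁻¹) by ring]
  refine h.congr' ?_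
  filter_upwards [eventually_gt_atTop 0] with m hm
  have := (Real.rpow_pos_of_pos (Nat.cast_pos.2 hm) (α * k)).ne'
  rw [wrightApprox]
  field_simp

lemma norm_wrightApprox_le (h0 : 0 < α) (hθ : 0 ≤ θ) {m : ℕ} (hm : 0 < m)
    (hαm : 2 * α * θ * (m : ℝ) ^ α ≤ m) (k : ℕ) :
    ‖wrightApprox α θ m k‖ ≤ (2 ^ α * θ) ^ k / k.factorial * Real.Gamma (1 + α * k) := by
  have := Real.Gamma_pos_of_pos (by positivity : 0 < 1 + α * k)
  rcases lt_or_ge ⌊θ * (m : ℝ) ^ α⌋₊ k with hk | hk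
  · rw [wrightApprox, Nat.choose_eq_zero_of_lt hk, Nat.cast_zero, mul_zero, zero_mul, zero_div,
      norm_zero]
    positivity
  have hfloor : (⌊θ * (m : ℝ) ^ α⌋₊ : ℝ) ≤ θ * (m : ℝ) ^ α := Nat.floor_le (by positivity)
  have hkm : 2 * (α * k) ≤ m := by
    calc 2 * (α * k) ≤ 2 * (α * (θ * (m : ℝ) ^ α)) := by
          gcongr
          exact le_trans (by exact_mod_cast hk) hfloor
      _ = 2 * α * θ * (m : ℝ) ^ α := by ring
      _ ≤ m := hαm
  have hchoose : ((⌊θ * (m : ℝ) ^ α⌋₊).choose k : ℝ) ≤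
      θ ^ k / k.factorial * (m : ℝ) ^ (α * k) := by
    refine (Nat.choose_le_pow_div k _).trans ?_
    rw [Real.rpow_mul_natCast (Nat.cast_nonneg m), div_mul_eq_mul_div, ← mul_pow]
    gcongr
  have hprod := abs_prod_range_natCast_sub_mul_rpow_le (by positivity : 0 ≤ α * k) hm hkm
  rw [wrightApprox, norm_div, norm_mul, norm_mul, norm_pow, norm_neg, norm_one, one_pow, one_mul,
    Real.norm_natCast, Real.norm_natCast, Real.norm_eq_abs]
  calc _ ≤ (θ ^ k / k.factorial * (m : ℝ) ^ (α * k)) *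
        |∏ i ∈ Finset.range (m + 1), ((i : ℝ) - α * k)| / m.factorial := by gcongr
    _ = θ ^ k / k.factorial * (|∏ i ∈ Finset.range (m + 1), ((i : ℝ) - α * k)| *
        (m : ℝ) ^ (α * k) / m.factorial) := by ring
    _ ≤ θ ^ k / k.factorial * (2 ^ (α * k) * Real.Gamma (1 + α * k)) := by gcongr
    _ = _ := by
      rw [Real.rpow_mul_natCast two_pos.le, mul_pow]
      ring

lemma wrightSeries_one_nonneg (h0 : 0 < α) (h1 : α < 1) (hθ : 0 < θ) :
    0 ≤ wrightSeries α 1 θ := by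
  have hlim : Tendsto (fun m => ∑' k, wrightApprox α θ m k) atTop (𝓝 (wrightSeries α 1 θ)) := by
    refine tendsto_tsum_of_dominated_convergence
      (summable_pow_div_factorial_mul_Gamma h0 h1 one_pos (by positivity : 0 ≤ 2 ^ α * θ))
      (tendsto_wrightApprox h0 hθ) ?_
    filter_upwards [eventually_gt_atTop 0, eventually_mul_rpow_le_self (2 * α * θ) h1]
      with m hm hαm using norm_wrightApprox_le h0 hθ.le hm hαm
  exact ge_of_tendsto' hlim (tsum_wrightApprox_nonneg h0.le h1.le θ)

lemma wrightSeries_eq_tsum_sin (h0 : 0 < α) (ha : 0 < a) (θ : ℝ) :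
    wrightSeries α a θ = ∑' k : ℕ, (-θ) ^ k / k.factorial *
      (Real.Gamma (a + α * k) * Real.sin (Real.pi * (a + α * k)) / Real.pi) := by
  refine tsum_congr fun k => ?_
  rw [← inv_Gamma_one_sub (by positivity), sub_sub, div_mul_eq_div_div,
    div_eq_mul_inv _ (Real.Gamma _)]

lemma summable_wrightSeries (h0 : 0 < α) (h1 : α < 1) (ha : 0 < a) (θ : ℝ) :
    Summable fun k : ℕ => (-θ) ^ k / ((k.factorial : ℝ) * Real.Gamma (1 - a - α * k)) := by
  refine Summable.of_norm_bounded
    (summable_pow_div_factorial_mul_Gamma h0 h1 ha (abs_nonneg θ)) fun k => ?_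
  rw [div_mul_eq_div_div, div_eq_mul_inv _ (Real.Gamma _), sub_sub, norm_mul, norm_div, norm_pow,
    norm_neg, Real.norm_natCast, Real.norm_eq_abs, Real.norm_eq_abs]
  gcongr
  exact abs_inv_Gamma_one_sub_le (by positivity)

lemma wrightSeries_one_eq_mul_wrightDensity (h0 : 0 < α) (h1 : α < 1) (θ : ℝ) :
    wrightSeries α 1 θ = α * θ * wrightDensity α θ := by
  rw [wrightSeries, (summable_wrightSeries h0 h1 one_pos θ).tsum_eq_zero_add, wrightDensity,
    ← tsum_mul_left]
  simp only [sub_self, Nat.cast_zero, mul_zero, Real.Gamma_zero, div_zero, zero_add, zero_sub]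
  refine tsum_congr fun k => ?_
  have hk : α * ((k + 1 : ℕ) : ℝ) ≠ 0 := by positivity
  have hΓ : Real.Gamma (1 - α - α * k) =
      -(α * ((k + 1 : ℕ) : ℝ)) * Real.Gamma (-(α * ((k + 1 : ℕ) : ℝ))) := by
    rw [← Real.Gamma_add_one (neg_ne_zero.2 hk)]
    push_cast
    ring_nf
  rw [hΓ, Nat.factorial_succ]
  rcases eq_or_ne (Real.Gamma (-(α * ((k + 1 : ℕ) : ℝ)))) 0 with hz | hz
  · rw [hz]
    simp
  · push_cast at hk hz ⊢
    field_simp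
    ring

lemma wrightDensity_nonneg (h0 : 0 < α) (h1 : α < 1) (hθ : 0 < θ) : 0 ≤ wrightDensity α θ := by
  have h := wrightSeries_one_nonneg h0 h1 hθ
  rw [wrightSeries_one_eq_mul_wrightDensity h0 h1] at h
  exact nonneg_of_mul_nonneg_right h (by positivity)

lemma measurable_wrightDensity (h0 : 0 < α) (h1 : α < 1) : Measurable (wrightDensity α) := by
  refine measurable_of_tendsto_metrizable (f := fun (n : ℕ) θ => ∑ k ∈ Finset.range n,
    (-θ) ^ k / ((k.factorial : ℝ) * Real.Gamma (1 - α - α * k))) (fun n => by fun_prop) ?_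
  exact tendsto_pi_nhds.2 fun θ => (summable_wrightSeries h0 h1 h0 θ).hasSum.tendsto_sum_nat

end Positivity

/-! ### Gamma integrals with complex rate -/

section ComplexGamma

variable {a : ℝ} {c : ℂ}

lemma integrableOn_rpow_mul_exp_neg_mul {b : ℝ} (ha : 0 < a) (hb : 0 < b) :
    IntegrableOn (fun r : ℝ => r ^ (a - 1) * Real.exp (-(b * r))) (Ioi 0) := by
  simpa using integrableOn_rpow_mul_exp_neg_mul_rpow (s := a - 1) (p := 1) (b := b) (by linarith)
    one_pos hb

lemma norm_cexp_neg_mul_ofReal (c : ℂ) (r : ℝ) :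
    ‖Complex.exp (-(c * r))‖ = Real.exp (-(c.re * r)) := by
  rw [Complex.norm_exp, Complex.neg_re, Complex.re_mul_ofReal]

lemma integrableOn_rpow_mul_cexp_neg_mul (ha : 0 < a) (hc : 0 < c.re) :
    IntegrableOn (fun r : ℝ => ((r ^ (a - 1) : ℝ) : ℂ) * Complex.exp (-(c * r))) (Ioi 0) := by
  refine (integrableOn_rpow_mul_exp_neg_mul ha hc).mono'
    (Measurable.aestronglyMeasurable (by fun_prop)) ?_
  refine (ae_restrict_iff' measurableSet_Ioi).2 (Eventually.of_forall fun r hr => ?_)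
  rw [norm_mul, norm_cexp_neg_mul_ofReal, Complex.norm_real,
    Real.norm_of_nonneg (Real.rpow_nonneg (le_of_lt hr) _)]

/-- The measure `r ^ (a - 1) dr` on `(0, ∞)`. Its complex moment generating function at `-c` is the
Gamma integral of rate `c`, so that the analyticity of `complexMGF` applies to the latter. -/
noncomputable def gammaWeight (a : ℝ) : Measure ℝ :=
  (volume.restrict (Ioi 0)).withDensity fun r => ENNReal.ofReal (r ^ (a - 1))

lemma complexMGF_gammaWeight (a : ℝ) (z : ℂ) :
    ProbabilityTheory.complexMGF id (gammaWeight a) z =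
      ∫ r in Ioi (0 : ℝ), ((r ^ (a - 1) : ℝ) : ℂ) * Complex.exp (z * r) := by
  rw [ProbabilityTheory.complexMGF, gammaWeight,
    integral_withDensity_eq_integral_toReal_smul (by fun_prop) (by simp)]
  refine setIntegral_congr_fun measurableSet_Ioi fun r hr => ?_
  simp [ENNReal.toReal_ofReal (Real.rpow_nonneg (le_of_lt hr) _)]

lemma Iio_subset_integrableExpSet_gammaWeight (ha : 0 < a) :
    Iio 0 ⊆ ProbabilityTheory.integrableExpSet id (gammaWeight a) := by
  intro t ht
  rw [ProbabilityTheory.integrableExpSet, mem_ofPred_eq, gammaWeight,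
    integrable_withDensity_iff_integrable_smul' (by fun_prop) (by simp)]
  refine (integrableOn_rpow_mul_exp_neg_mul ha (neg_pos.2 ht)).congr_fun (fun r hr => ?_)
    measurableSet_Ioi
  simp [ENNReal.toReal_ofReal (Real.rpow_nonneg (le_of_lt hr) _)]

lemma complexMGF_gammaWeight_ofReal (ha : 0 < a) {t : ℝ} (ht : t < 0) :
    ProbabilityTheory.complexMGF id (gammaWeight a) t = (-t : ℂ) ^ (-(a : ℂ)) * Real.Gamma a := by
  have h := Complex.integral_cpow_mul_exp_neg_mul_Ioi (a := a) (by simpa using ha) (neg_pos.2 ht)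
  have harg : (-t : ℂ).arg ≠ Real.pi := by
    rw [← Complex.ofReal_neg, Complex.arg_ofReal_of_nonneg (neg_pos.2 ht).le]
    exact Real.pi_pos.ne
  rw [Complex.ofReal_neg, one_div, Complex.inv_cpow _ _ harg, ← Complex.cpow_neg] at h
  rw [complexMGF_gammaWeight, ← Complex.Gamma_ofReal, ← h]
  refine setIntegral_congr_fun measurableSet_Ioi fun r hr => ?_
  rw [Complex.ofReal_cpow (le_of_lt hr), Complex.ofReal_sub, Complex.ofReal_one, neg_mul, neg_neg]

lemma integral_rpow_mul_cexp_neg_mul (ha : 0 < a) (hc : 0 < c.re) :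
    ∫ r in Ioi (0 : ℝ), ((r ^ (a - 1) : ℝ) : ℂ) * Complex.exp (-(c * r)) =
      c ^ (-(a : ℂ)) * Real.Gamma a := by
  have hmgf : AnalyticOnNhd ℂ (ProbabilityTheory.complexMGF id (gammaWeight a))
      {z : ℂ | z.re < 0} :=
    ProbabilityTheory.analyticOnNhd_complexMGF.mono fun z hz =>
      interior_mono (Iio_subset_integrableExpSet_gammaWeight ha) (by rwa [interior_Iio])
  have hpow : AnalyticOnNhd ℂ (fun z : ℂ => (-z) ^ (-(a : ℂ)) * (Real.Gamma a : ℂ))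
      {z : ℂ | z.re < 0} := by
    refine DifferentiableOn.analyticOnNhd (fun z hz => ?_)
      (isOpen_lt Complex.continuous_re continuous_const)
    refine ((differentiableAt_id.neg.cpow (by fun_prop) (Or.inl ?_)).mul_const
      _).differentiableWithinAt
    simpa using hz
  have hreal : Tendsto ((↑) : ℝ → ℂ) (𝓝[≠] (-1)) (𝓝[≠] (-1)) := by
    simpa using Complex.continuous_ofReal.continuousAt.continuousWithinAt.tendsto_nhdsWithin
      (s := {(-1 : ℝ)}ᶜ) (t := {(-1 : ℂ)}ᶜ) (x := -1) fun t ht h =>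
        ht (Complex.ofReal_injective (by simpa using h))
  have hfreq : ∃ᶠ z in 𝓝[≠] (-1 : ℂ), ProbabilityTheory.complexMGF id (gammaWeight a) z =
      (-z) ^ (-(a : ℂ)) * (Real.Gamma a : ℂ) := by
    refine hreal.frequently (Eventually.frequently ?_)
    filter_upwards [nhdsWithin_le_nhds (Iio_mem_nhds (by norm_num : (-1 : ℝ) < 0))]
      with t ht using complexMGF_gammaWeight_ofReal ha ht
  have h := hmgf.eqOn_of_preconnected_of_frequently_eq hpow
    (convex_halfSpace_re_lt 0).isPreconnected (by simp : (-1 : ℂ) ∈ {z : ℂ | z.re < 0}) hfreq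
    (by simpa using hc : -c ∈ {z : ℂ | z.re < 0})
  rw [complexMGF_gammaWeight] at h
  simpa using h

lemma ofReal_mul_cexp_cpow {ρ φ : ℝ} (hρ : 0 < ρ) (hφ : |φ| < Real.pi) (s : ℝ) :
    (ρ * Complex.exp (φ * Complex.I)) ^ (s : ℂ) =
      (ρ ^ s : ℝ) * Complex.exp ((s * φ : ℝ) * Complex.I) := by
  obtain ⟨h1, h2⟩ := abs_lt.1 hφ
  have him : (φ * Complex.I).im = φ := by simp
  rw [Complex.cpow_def_of_ne_zero (mul_ne_zero (by exact_mod_cast hρ.ne') (Complex.exp_ne_zero _)),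
    Complex.log_ofReal_mul hρ (Complex.exp_ne_zero _),
    Complex.log_exp (him.symm ▸ h1) (him.symm ▸ h2.le), Real.rpow_def_of_pos hρ, add_mul,
    Complex.exp_add]
  push_cast
  ring_nf

end ComplexGamma

/-! ### Mellin transform of the Wright function -/

section Mellin

variable {α : ℝ}

/-- The angle `π / (1 + α)` of the ray `z = r e ^ (i π / (1 + α))`, `r > 0`, along which both
`e ^ z` and `e ^ (-z ^ α)` decay. -/
noncomputable def rayAngle (α : ℝ) : ℝ := Real.pi / (1 + α)

lemma abs_rayAngle_sub_pi_lt (h0 : 0 < α) (h1 : α < 1) : |rayAngle α - Real.pi| < Real.pi / 2 := by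
  have hpi := Real.pi_pos
  have e : rayAngle α - Real.pi = -(Real.pi * α / (1 + α)) := by
    rw [rayAngle]
    field_simp
    ring
  rw [e, abs_neg, abs_of_pos (by positivity), div_lt_div_iff₀ (by positivity) (by norm_num)]
  nlinarith

lemma abs_mul_rayAngle_lt (h0 : 0 < α) (h1 : α < 1) : |α * rayAngle α| < Real.pi / 2 := by
  have hpi := Real.pi_pos
  rw [rayAngle, abs_of_pos (by positivity), ← mul_div_assoc,
    div_lt_div_iff₀ (by positivity) (by norm_num)]
  nlinarith

lemma cos_rayAngle_sub_pi_pos (h0 : 0 < α) (h1 : α < 1) : 0 < Real.cos (rayAngle α - Real.pi) :=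
  Real.cos_pos_of_mem_Ioo (abs_lt.1 (abs_rayAngle_sub_pi_lt h0 h1))

lemma cos_mul_rayAngle_pos (h0 : 0 < α) (h1 : α < 1) : 0 < Real.cos (α * rayAngle α) :=
  Real.cos_pos_of_mem_Ioo (abs_lt.1 (abs_mul_rayAngle_lt h0 h1))

/-- The differential `z ^ (s - 1) e ^ z dz` along the ray `z = r e ^ (i π / (1 + α))`. -/
noncomputable def rayGamma (α s r : ℝ) : ℂ :=
  Complex.exp ((s * rayAngle α : ℝ) * Complex.I) * (((r ^ (s - 1) : ℝ) : ℂ) *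
    Complex.exp (-(Complex.exp ((rayAngle α - Real.pi : ℝ) * Complex.I) * r)))

/-- The values of `z ^ α` on the ray `z = r e ^ (i π / (1 + α))`. -/
noncomputable def rayPow (α r : ℝ) : ℂ :=
  (r ^ α : ℝ) * Complex.exp ((α * rayAngle α : ℝ) * Complex.I)

@[fun_prop]
lemma measurable_rayGamma (α s : ℝ) : Measurable (rayGamma α s) := by
  unfold rayGamma
  fun_prop

@[fun_prop]
lemma measurable_rayPow (α : ℝ) : Measurable (rayPow α) := by
  unfold rayPow
  fun_prop

lemma norm_rayGamma (α s : ℝ) {r : ℝ} (hr : 0 ≤ r) :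
    ‖rayGamma α s r‖ = r ^ (s - 1) * Real.exp (-(Real.cos (rayAngle α - Real.pi) * r)) := by
  rw [rayGamma, norm_mul, norm_mul, Complex.norm_exp_ofReal_mul_I, norm_cexp_neg_mul_ofReal,
    Complex.exp_ofReal_mul_I_re, Complex.norm_real, Real.norm_of_nonneg (Real.rpow_nonneg hr _),
    one_mul]

lemma rayPow_re (α r : ℝ) : (rayPow α r).re = r ^ α * Real.cos (α * rayAngle α) := by
  rw [rayPow, Complex.re_ofReal_mul, Complex.exp_ofReal_mul_I_re]

lemma rayPow_re_pos (h0 : 0 < α) (h1 : α < 1) {r : ℝ} (hr : 0 < r) : 0 < (rayPow α r).re := by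
  rw [rayPow_re]
  exact mul_pos (Real.rpow_pos_of_pos hr α) (cos_mul_rayAngle_pos h0 h1)

lemma rayGamma_mul_rayPow_cpow (h0 : 0 < α) (h1 : α < 1) (s t : ℝ) {r : ℝ} (hr : 0 < r) :
    rayGamma α s r * rayPow α r ^ (t : ℂ) = rayGamma α (s + α * t) r := by
  rw [rayPow, ofReal_mul_cexp_cpow (Real.rpow_pos_of_pos hr α)
    ((abs_mul_rayAngle_lt h0 h1).trans (half_lt_self Real.pi_pos)), ← Real.rpow_mul hr.le,
    rayGamma, rayGamma, show s + α * t - 1 = s - 1 + α * t by ring, Real.rpow_add hr,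
    show (s + α * t) * rayAngle α = s * rayAngle α + t * (α * rayAngle α) by ring,
    Complex.ofReal_add (s * rayAngle α), add_mul, Complex.exp_add]
  push_cast
  ring

lemma integrableOn_rayGamma (h0 : 0 < α) (h1 : α < 1) {s : ℝ} (hs : 0 < s) :
    IntegrableOn (rayGamma α s) (Ioi 0) := by
  refine (integrableOn_rpow_mul_cexp_neg_mul hs ?_).const_mul _
  rw [Complex.exp_ofReal_mul_I_re]
  exact cos_rayAngle_sub_pi_pos h0 h1

lemma integral_rayGamma (h0 : 0 < α) (h1 : α < 1) {s : ℝ} (hs : 0 < s) :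
    ∫ r in Ioi (0 : ℝ), rayGamma α s r =
      Real.Gamma s * Complex.exp ((Real.pi * s : ℝ) * Complex.I) := by
  have hcpow := ofReal_mul_cexp_cpow one_pos
    ((abs_rayAngle_sub_pi_lt h0 h1).trans (half_lt_self Real.pi_pos)) (-s)
  rw [Complex.ofReal_one, one_mul, Real.one_rpow, Complex.ofReal_one, one_mul,
    Complex.ofReal_neg] at hcpow
  simp only [rayGamma]
  rw [integral_const_mul, integral_rpow_mul_cexp_neg_mul hs, hcpow, ← mul_assoc,
    ← Complex.exp_add, mul_comm]
  · push_cast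
    ring_nf
  · rw [Complex.exp_ofReal_mul_I_re]
    exact cos_rayAngle_sub_pi_pos h0 h1

lemma summable_integral_norm_rayGamma (h0 : 0 < α) (h1 : α < 1) {a : ℝ} (ha : 0 < a) (θ : ℝ) :
    Summable fun k : ℕ => ∫ r in Ioi (0 : ℝ),
      ‖(((-θ) ^ k / k.factorial : ℝ) : ℂ) * rayGamma α (a + α * k) r‖ := by
  have hcos := cos_rayAngle_sub_pi_pos h0 h1
  set b := 1 / Real.cos (rayAngle α - Real.pi)
  have hb0 : 0 < b := by positivity
  refine ((summable_pow_div_factorial_mul_Gamma h0 h1 ha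
    (by positivity : 0 ≤ |θ| * b ^ α)).mul_left (b ^ a)).congr fun k => ?_
  have hnorm : ∫ r in Ioi (0 : ℝ), ‖(((-θ) ^ k / k.factorial : ℝ) : ℂ) *
      rayGamma α (a + α * k) r‖ = |θ| ^ k / k.factorial *
        (b ^ (a + α * k) * Real.Gamma (a + α * k)) := by
    rw [← Real.integral_rpow_mul_exp_neg_mul_Ioi (by positivity) hcos, ← integral_const_mul]
    refine setIntegral_congr_fun measurableSet_Ioi fun r hr => ?_
    rw [norm_mul, norm_rayGamma _ _ (le_of_lt hr), Complex.norm_real, norm_div, norm_pow, norm_neg,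
      Real.norm_natCast, Real.norm_eq_abs]
  rw [hnorm, Real.rpow_add hb0, Real.rpow_mul_natCast hb0.le, mul_pow]
  ring

lemma tsum_mul_rayGamma (h0 : 0 < α) (h1 : α < 1) (a θ : ℝ) {r : ℝ} (hr : 0 < r) :
    ∑' k : ℕ, (((-θ) ^ k / k.factorial : ℝ) : ℂ) * rayGamma α (a + α * k) r =
      rayGamma α a r * Complex.exp (-(rayPow α r * θ)) := by
  rw [Complex.exp_eq_exp_ℂ, NormedSpace.exp_eq_tsum_div, ← tsum_mul_left]
  refine tsum_congr fun k => ?_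
  rw [← rayGamma_mul_rayPow_cpow h0 h1 a k hr, Complex.ofReal_natCast, Complex.cpow_natCast,
    ← mul_neg, mul_pow]
  push_cast
  ring

lemma wrightSeries_eq_integral (h0 : 0 < α) (h1 : α < 1) {a : ℝ} (ha : 0 < a) (θ : ℝ) :
    wrightSeries α a θ =
      (∫ r in Ioi (0 : ℝ), rayGamma α a r * Complex.exp (-(rayPow α r * θ))).im / Real.pi := by
  have hsum := hasSum_integral_of_summable_integral_norm
    (fun k : ℕ => (integrableOn_rayGamma h0 h1 (by positivity : 0 < a + α * k)).const_mul
      (((-θ) ^ k / k.factorial : ℝ) : ℂ)) (summable_integral_norm_rayGamma h0 h1 ha θ)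
  rw [setIntegral_congr_fun measurableSet_Ioi fun r hr => tsum_mul_rayGamma h0 h1 a θ hr] at hsum
  rw [wrightSeries_eq_tsum_sin h0 ha, ← ((Complex.hasSum_im hsum).div_const Real.pi).tsum_eq]
  refine tsum_congr fun k => ?_
  rw [integral_const_mul, integral_rayGamma h0 h1 (by positivity), Complex.im_ofReal_mul,
    Complex.im_ofReal_mul, Complex.exp_ofReal_mul_I_im]
  ring

lemma integral_norm_rpow_mul_rayGamma (h0 : 0 < α) (h1 : α < 1) (a : ℝ) {z r : ℝ} (hz : 0 < z)
    (hr : 0 < r) :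
    ∫ θ in Ioi (0 : ℝ), ‖((θ ^ (z - 1) : ℝ) : ℂ) *
        (rayGamma α a r * Complex.exp (-(rayPow α r * θ)))‖ =
      Real.cos (α * rayAngle α) ^ (-z) * Real.Gamma z * ‖rayGamma α (a - α * z) r‖ := by
  have hcos := cos_mul_rayAngle_pos h0 h1
  have hnorm : ∫ θ in Ioi (0 : ℝ), ‖((θ ^ (z - 1) : ℝ) : ℂ) *
      (rayGamma α a r * Complex.exp (-(rayPow α r * θ)))‖ =
        ∫ θ in Ioi (0 : ℝ), ‖rayGamma α a r‖ *
          (θ ^ (z - 1) * Real.exp (-((rayPow α r).re * θ))) := by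
    refine setIntegral_congr_fun measurableSet_Ioi fun θ hθ => ?_
    rw [norm_mul, norm_mul, norm_cexp_neg_mul_ofReal, Complex.norm_real,
      Real.norm_of_nonneg (Real.rpow_nonneg (le_of_lt hθ) _), mul_left_comm]
  rw [hnorm, integral_const_mul, Real.integral_rpow_mul_exp_neg_mul_Ioi hz
    (rayPow_re_pos h0 h1 hr), rayPow_re, one_div, Real.inv_rpow (by positivity),
    ← Real.rpow_neg (by positivity), Real.mul_rpow (by positivity) hcos.le, ← Real.rpow_mul hr.le,
    norm_rayGamma _ _ hr.le, norm_rayGamma _ _ hr.le,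
    show a - α * z - 1 = a - 1 + α * -z by ring, Real.rpow_add hr]
  ring

lemma integral_rpow_mul_rayGamma (h0 : 0 < α) (h1 : α < 1) (a : ℝ) {z r : ℝ} (hz : 0 < z)
    (hr : 0 < r) :
    ∫ θ in Ioi (0 : ℝ), ((θ ^ (z - 1) : ℝ) : ℂ) *
        (rayGamma α a r * Complex.exp (-(rayPow α r * θ))) =
      Real.Gamma z * rayGamma α (a - α * z) r := by
  simp only [mul_left_comm _ (rayGamma α a r)]
  rw [integral_const_mul, integral_rpow_mul_cexp_neg_mul hz (rayPow_re_pos h0 h1 hr), ← mul_assoc,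
    ← Complex.ofReal_neg, rayGamma_mul_rayPow_cpow h0 h1 a (-z) hr, mul_neg, ← sub_eq_add_neg,
    mul_comm]

lemma integrable_rpow_mul_rayGamma (h0 : 0 < α) (h1 : α < 1) {a z : ℝ} (hz : 0 < z)
    (hza : α * z < a) :
    Integrable (fun x : ℝ × ℝ => ((x.1 ^ (z - 1) : ℝ) : ℂ) *
        (rayGamma α a x.2 * Complex.exp (-(rayPow α x.2 * x.1))))
      ((volume.restrict (Ioi 0)).prod (volume.restrict (Ioi 0))) := by
  rw [integrable_prod_iff' (Measurable.aestronglyMeasurable (by fun_prop))]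
  constructor
  · refine (ae_restrict_iff' measurableSet_Ioi).2 (Eventually.of_forall fun r hr => ?_)
    simp only [mul_left_comm _ (rayGamma α a r)]
    exact (integrableOn_rpow_mul_cexp_neg_mul hz (rayPow_re_pos h0 h1 hr)).const_mul _
  · refine IntegrableOn.congr_fun ?_
      (fun r hr => (integral_norm_rpow_mul_rayGamma h0 h1 a hz hr).symm) measurableSet_Ioi
    exact (integrableOn_rayGamma h0 h1 (sub_pos.2 hza)).norm.const_mul _

lemma rpow_mul_wrightSeries_eq (h0 : 0 < α) (h1 : α < 1) {a : ℝ} (ha : 0 < a) (z θ : ℝ) :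
    θ ^ (z - 1) * wrightSeries α a θ = (∫ r in Ioi (0 : ℝ), ((θ ^ (z - 1) : ℝ) : ℂ) *
      (rayGamma α a r * Complex.exp (-(rayPow α r * θ)))).im / Real.pi := by
  rw [integral_const_mul, Complex.im_ofReal_mul, wrightSeries_eq_integral h0 h1 ha, mul_div_assoc]

lemma integrableOn_rpow_mul_wrightSeries (h0 : 0 < α) (h1 : α < 1) {a z : ℝ} (hz : 0 < z)
    (hza : α * z < a) : IntegrableOn (fun θ => θ ^ (z - 1) * wrightSeries α a θ) (Ioi 0) := by
  simp only [rpow_mul_wrightSeries_eq h0 h1 ((mul_pos h0 hz).trans hza) z]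
  exact (integrable_rpow_mul_rayGamma h0 h1 hz hza).integral_prod_left.im.div_const _

lemma integral_rpow_mul_wrightSeries (h0 : 0 < α) (h1 : α < 1) {a z : ℝ} (hz : 0 < z)
    (hza : α * z < a) :
    ∫ θ in Ioi (0 : ℝ), θ ^ (z - 1) * wrightSeries α a θ =
      Real.Gamma z / Real.Gamma (1 - (a - α * z)) := by
  have integrable_prod := integrable_rpow_mul_rayGamma h0 h1 hz hza
  simp only [rpow_mul_wrightSeries_eq h0 h1 ((mul_pos h0 hz).trans hza) z]
  have him := integral_im integrable_prod.integral_prod_left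
  simp only [RCLike.im_eq_complex_im] at him
  rw [integral_div, him, integral_integral_swap integrable_prod,
    setIntegral_congr_fun measurableSet_Ioi fun r hr => integral_rpow_mul_rayGamma h0 h1 a hz hr,
    integral_const_mul, integral_rayGamma h0 h1 (sub_pos.2 hza),
    Complex.im_ofReal_mul, Complex.im_ofReal_mul, Complex.exp_ofReal_mul_I_im,
    div_eq_mul_inv (Real.Gamma z), inv_Gamma_one_sub (sub_pos.2 hza), mul_div_assoc]

end Mellin

/-! ### Moments of the Wright density -/

section Moments

variable {α : ℝ}

lemma ae_rpow_mul_wrightDensity_nonneg (h0 : 0 < α) (h1 : α < 1) (s : ℝ) :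
    0 ≤ᵐ[volume.restrict (Ioi 0)] fun θ => θ ^ s * wrightDensity α θ :=
  (ae_restrict_iff' measurableSet_Ioi).2 (Eventually.of_forall fun _ hθ =>
    mul_nonneg (Real.rpow_nonneg (le_of_lt hθ) _) (wrightDensity_nonneg h0 h1 hθ))

lemma lintegral_rpow_neg_mul_wrightDensity_le (h0 : 0 < α) (h1 : α < 1) {γ : ℝ} (hγ0 : 0 < γ)
    (hγ1 : γ < 1) :
    ∫⁻ θ in Ioi (0 : ℝ), ENNReal.ofReal (θ ^ (-γ) * wrightDensity α θ) ≤
      ENNReal.ofReal (Real.Gamma (1 - γ)) := by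
  have hγ : 0 < 1 - γ := sub_pos.2 hγ1
  have hi := integrableOn_rpow_mul_wrightSeries (a := α) h0 h1 hγ (by nlinarith)
  have he := integral_rpow_mul_wrightSeries (a := α) h0 h1 hγ (by nlinarith)
  simp only [sub_sub_cancel_left, ← wrightDensity_eq_wrightSeries] at hi he
  rw [← ofReal_integral_eq_lintegral_ofReal hi (ae_rpow_mul_wrightDensity_nonneg h0 h1 _), he]
  exact ENNReal.ofReal_le_ofReal (div_le_self (Real.Gamma_pos_of_pos hγ).le
    (one_le_Gamma (by nlinarith) (by nlinarith)))

lemma lintegral_rpow_mul_wrightDensity (h0 : 0 < α) (h1 : α < 1) {z : ℝ} (hz0 : 0 < z)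
    (hz1 : z ≤ 1) :
    ∫⁻ θ in Ioi (0 : ℝ), ENNReal.ofReal (θ ^ z * wrightDensity α θ) =
      ENNReal.ofReal (Real.Gamma (1 + z) / Real.Gamma (1 + α * z)) := by
  have hzα : α * z < 1 := by nlinarith
  have e : EqOn (fun θ => θ ^ z * wrightDensity α θ)
      (fun θ => α⁻¹ * (θ ^ (z - 1) * wrightSeries α 1 θ)) (Ioi 0) := by
    intro θ hθ
    simp only [wrightSeries_one_eq_mul_wrightDensity h0 h1]
    rw [Real.rpow_sub_one (mem_Ioi.1 hθ).ne']
    have := (mem_Ioi.1 hθ).ne'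
    field_simp
  have hi : IntegrableOn (fun θ => θ ^ z * wrightDensity α θ) (Ioi 0) :=
    IntegrableOn.congr_fun ((integrableOn_rpow_mul_wrightSeries h0 h1 hz0 hzα).const_mul α⁻¹)
      e.symm measurableSet_Ioi
  rw [← ofReal_integral_eq_lintegral_ofReal hi (ae_rpow_mul_wrightDensity_nonneg h0 h1 _),
    setIntegral_congr_fun measurableSet_Ioi e, integral_const_mul,
    integral_rpow_mul_wrightSeries h0 h1 hz0 hzα, sub_sub_cancel, add_comm 1 z,
    Real.Gamma_add_one hz0.ne', add_comm 1 (α * z), Real.Gamma_add_one (by positivity)]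
  congr 1
  field_simp

lemma lintegral_id_mul_wrightDensity_le (h0 : 0 < α) (h1 : α < 1) :
    ∫⁻ θ in Ioi (0 : ℝ), ENNReal.ofReal (θ * wrightDensity α θ) ≤ ENNReal.ofReal 2 := by
  have h := lintegral_rpow_mul_wrightDensity h0 h1 one_pos le_rfl
  simp only [Real.rpow_one, mul_one] at h
  have hΓ := half_le_Gamma (x := 1 + α) (by linarith) (by linarith)
  rw [h, one_add_one_eq_two, Real.Gamma_two]
  refine ENNReal.ofReal_le_ofReal ?_
  rw [div_le_iff₀ (by linarith)]
  linarith

lemma lintegral_rpow_neg_mul_id_mul_wrightDensity_le (h0 : 0 < α) (h1 : α < 1) {γ : ℝ}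
    (hγ0 : 0 ≤ γ) (hγ1 : γ < 1) :
    ∫⁻ θ in Ioi (0 : ℝ), ENNReal.ofReal (θ ^ (-γ) * (θ * wrightDensity α θ)) ≤
      ENNReal.ofReal 2 := by
  have hγ : 0 < 1 - γ := sub_pos.2 hγ1
  have e : EqOn (fun θ => ENNReal.ofReal (θ ^ (-γ) * (θ * wrightDensity α θ)))
      (fun θ => ENNReal.ofReal (θ ^ (1 - γ) * wrightDensity α θ)) (Ioi 0) := by
    intro θ hθ
    simp only [sub_eq_neg_add, Real.rpow_add_one (mem_Ioi.1 hθ).ne', mul_assoc]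
  rw [setLIntegral_congr_fun measurableSet_Ioi e,
    lintegral_rpow_mul_wrightDensity h0 h1 hγ (by linarith)]
  refine ENNReal.ofReal_le_ofReal ?_
  have hnum := Gamma_le_one (x := 1 + (1 - γ)) (by linarith) (by linarith)
  have hden := half_le_Gamma (x := 1 + α * (1 - γ)) (by nlinarith) (by nlinarith)
  rw [div_le_iff₀ (by linarith)]
  linarith

lemma half_le_lintegral_rpow_half_mul_wrightDensity (h0 : 0 < α) (h1 : α < 1) :
    ENNReal.ofReal (1 / 2) ≤
      ∫⁻ θ in Ioi (0 : ℝ), ENNReal.ofReal (θ ^ (1 / 2 : ℝ) * wrightDensity α θ) := by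
  rw [lintegral_rpow_mul_wrightDensity h0 h1 (by norm_num) (by norm_num)]
  refine ENNReal.ofReal_le_ofReal ?_
  have hden := Gamma_le_one (x := 1 + α * (1 / 2)) (by linarith) (by linarith)
  have hnum := half_le_Gamma (x := 1 + 1 / 2) (by norm_num) (by norm_num)
  rw [le_div_iff₀ (Real.Gamma_pos_of_pos (by linarith))]
  linarith

lemma lintegral_rpow_neg_quarter_mul_wrightDensity_le (h0 : 0 < α) (h1 : α < 1) :
    ∫⁻ θ in Ioi (0 : ℝ), ENNReal.ofReal (θ ^ (-(1 / 4) : ℝ) * wrightDensity α θ) ≤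
      ENNReal.ofReal (4 / 3) := by
  refine (lintegral_rpow_neg_mul_wrightDensity_le h0 h1 (γ := 1 / 4) (by norm_num)
    (by norm_num)).trans (ENNReal.ofReal_le_ofReal ?_)
  have h := Real.Gamma_add_one (s := 1 - 1 / 4) (by norm_num)
  have h2 := Gamma_le_one (x := 1 - 1 / 4 + 1) (by norm_num) (by norm_num)
  linarith

lemma rpow_half_le_of_notMem_Icc {θ : ℝ} (hθ : 0 < θ) (h : θ ∉ Icc (1 / 256 : ℝ) 64) :
    θ ^ (1 / 2 : ℝ) ≤ 1 / 64 * θ ^ (-(1 / 4) : ℝ) + 1 / 8 * θ := by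
  have hpow := Real.rpow_pos_of_pos hθ (-(1 / 4))
  rcases lt_or_ge θ (1 / 256) with hsmall | hlarge
  · have h34 : θ ^ (3 / 4 : ℝ) ≤ 1 / 64 :=
      calc θ ^ (3 / 4 : ℝ) ≤ (1 / 256) ^ (3 / 4 : ℝ) := by gcongr
        _ = 1 / 64 := by
          rw [show (1 / 256 : ℝ) = (1 / 4) ^ (4 : ℝ) by norm_num, ← Real.rpow_mul (by norm_num)]
          norm_num
    rw [show (1 / 2 : ℝ) = 3 / 4 + -(1 / 4) by norm_num, Real.rpow_add hθ]
    nlinarith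
  · have h64 : 64 < θ := not_le.1 fun h64 => h ⟨hlarge, h64⟩
    have hsqrt : √θ ≤ 1 / 8 * θ := Real.sqrt_le_iff.2 ⟨by linarith, by nlinarith⟩
    rw [← Real.sqrt_eq_rpow]
    linarith

/-- The moments of order `-1/4`, `1/2` and `1` prevent the mass from escaping to `0` or `∞`. -/
lemma le_lintegral_wrightDensity_Icc (h0 : 0 < α) (h1 : α < 1) :
    ENNReal.ofReal (1 / 64) ≤
      ∫⁻ θ in Icc (1 / 256 : ℝ) 64, ENNReal.ofReal (wrightDensity α θ) := by
  have hm := measurable_wrightDensity h0 h1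
  have hpos : Icc (1 / 256 : ℝ) 64 ⊆ Ioi 0 := fun θ hθ => mem_Ioi.2 (by linarith [hθ.1])
  have hin : ∫⁻ θ in Icc (1 / 256 : ℝ) 64, ENNReal.ofReal (θ ^ (1 / 2 : ℝ) * wrightDensity α θ) ≤
      ENNReal.ofReal 8 * ∫⁻ θ in Icc (1 / 256 : ℝ) 64, ENNReal.ofReal (wrightDensity α θ) := by
    rw [← lintegral_const_mul _ (by fun_prop)]
    refine setLIntegral_mono' measurableSet_Icc fun θ hθ => ?_
    have hw := wrightDensity_nonneg h0 h1 (hpos hθ)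
    rw [← ENNReal.ofReal_mul (by norm_num), ← Real.sqrt_eq_rpow]
    gcongr
    exact Real.sqrt_le_iff.2 ⟨by norm_num, by linarith [hθ.2]⟩
  have hout : ∫⁻ θ in Ioi 0 \ Icc (1 / 256 : ℝ) 64,
      ENNReal.ofReal (θ ^ (1 / 2 : ℝ) * wrightDensity α θ) ≤
        ENNReal.ofReal (1 / 64) * ENNReal.ofReal (4 / 3) +
          ENNReal.ofReal (1 / 8) * ENNReal.ofReal 2 := by
    refine le_trans ?_ (add_le_add
      (mul_le_mul_right (lintegral_rpow_neg_quarter_mul_wrightDensity_le h0 h1) _)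
      (mul_le_mul_right (lintegral_id_mul_wrightDensity_le h0 h1) _))
    rw [← lintegral_const_mul _ (by fun_prop), ← lintegral_const_mul _ (by fun_prop),
      ← lintegral_add_left (by fun_prop)]
    refine (setLIntegral_mono' (measurableSet_Ioi.diff measurableSet_Icc) fun θ hθ => ?_).trans
      (lintegral_mono_set sdiff_subset)
    have hw := wrightDensity_nonneg h0 h1 hθ.1
    have hθ0 : 0 < θ := hθ.1
    rw [← ENNReal.ofReal_mul (by norm_num), ← ENNReal.ofReal_mul (by norm_num),
      ← ENNReal.ofReal_add (by positivity) (by positivity), ← mul_assoc, ← mul_assoc, ← add_mul]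
    gcongr
    exact rpow_half_le_of_notMem_Icc hθ0 hθ.2
  have htotal := half_le_lintegral_rpow_half_mul_wrightDensity h0 h1
  rw [← lintegral_inter_add_sdiff _ _ (measurableSet_Icc (a := (1 / 256 : ℝ)) (b := 64)),
    inter_eq_right.2 hpos] at htotal
  by_contra! hlt
  have hlt' := htotal.trans (add_le_add (hin.trans (mul_le_mul_right hlt.le _)) hout)
  rw [← ENNReal.ofReal_mul (by norm_num), ← ENNReal.ofReal_mul (by norm_num),
    ← ENNReal.ofReal_mul (by norm_num), ← ENNReal.ofReal_add (by norm_num) (by norm_num),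
    ← ENNReal.ofReal_add (by norm_num) (by norm_num), ENNReal.ofReal_le_ofReal_iff (by norm_num)]
    at hlt'
  norm_num at hlt'

end Moments

/-! ### The heat kernel -/

section HeatKernel

variable {N : ℕ}

@[fun_prop]
lemma measurable_heatKernel {β : Type*} [MeasurableSpace β] {f : β → ℝ} {g : β → Space N}
    (hf : Measurable f) (hg : Measurable g) : Measurable fun b => heatKernel N (f b) (g b) := by
  unfold heatKernel
  fun_prop

lemma heatKernel_pos {t : ℝ} (ht : 0 < t) (x : Space N) : 0 < heatKernel N t x := by
  have := Real.pi_pos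
  unfold heatKernel
  positivity

lemma heatKernel_le {t : ℝ} (ht : 0 < t) (x : Space N) :
    heatKernel N t x ≤ t ^ (-((N : ℝ) / 2)) := by
  have := Real.pi_gt_three
  rw [heatKernel, Real.rpow_neg ht.le, ← one_div, ← mul_one (1 / t ^ ((N : ℝ) / 2))]
  gcongr
  · nlinarith
  · exact Real.exp_le_one_iff.2 (div_nonpos_of_nonpos_of_nonneg (by simp) (by positivity))

lemma integral_heatKernel {t : ℝ} (ht : 0 < t) : ∫ x : Space N, heatKernel N t x = 1 := by
  have := Real.pi_pos
  have hG := GaussianFourier.integral_rexp_neg_mul_sq_norm (V := Space N) (b := 1 / (4 * t))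
    (by positivity)
  rw [finrank_euclideanSpace_fin, show Real.pi / (1 / (4 * t)) = 4 * Real.pi * t by field_simp]
    at hG
  have hexp : ∀ x : Space N, -‖x‖ ^ 2 / (4 * t) = -(1 / (4 * t)) * ‖x‖ ^ 2 := fun x => by ring
  simp only [heatKernel, hexp]
  rw [integral_const_mul, hG]
  exact one_div_mul_cancel (by positivity)

lemma lintegral_heatKernel {t : ℝ} (ht : 0 < t) :
    ∫⁻ x : Space N, ENNReal.ofReal (heatKernel N t x) = 1 := by
  have h := integral_heatKernel (N := N) ht
  rw [← ofReal_integral_eq_lintegral_ofReal (.of_integral_ne_zero (h.trans_ne one_ne_zero))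
    (Eventually.of_forall fun x => (heatKernel_pos ht x).le), h, ENNReal.ofReal_one]

lemma lintegral_heatKernel_sub {t : ℝ} (ht : 0 < t) (y : Space N) :
    ∫⁻ x, ENNReal.ofReal (heatKernel N t (x - y)) = 1 := by
  rw [lintegral_sub_right_eq_self (fun x => ENNReal.ofReal (heatKernel N t x)) y,
    lintegral_heatKernel ht]

lemma lintegral_heatKernel_sub_rpow_le {t p : ℝ} (ht : 0 < t) (hp : 1 ≤ p) (y : Space N) :
    ∫⁻ x, ENNReal.ofReal (heatKernel N t (x - y)) ^ p ≤
      ENNReal.ofReal (t ^ (-((N : ℝ) * (p - 1) / (2 * p)))) ^ p := by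
  have : 0 ≤ p - 1 := sub_nonneg.2 hp
  have hpt : ∀ x, ENNReal.ofReal (heatKernel N t (x - y)) ^ p ≤
      ENNReal.ofReal (t ^ (-((N : ℝ) * (p - 1) / 2))) *
        ENNReal.ofReal (heatKernel N t (x - y)) := by
    intro x
    have hG := heatKernel_pos ht (x - y)
    rw [ENNReal.ofReal_rpow_of_nonneg hG.le (by linarith), ← ENNReal.ofReal_mul (by positivity)]
    refine ENNReal.ofReal_le_ofReal ?_
    calc heatKernel N t (x - y) ^ p
        = heatKernel N t (x - y) ^ (p - 1) * heatKernel N t (x - y) := by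
          rw [← Real.rpow_add_one hG.ne', sub_add_cancel]
      _ ≤ (t ^ (-((N : ℝ) / 2))) ^ (p - 1) * heatKernel N t (x - y) := by
          gcongr
          exact heatKernel_le ht _
      _ = t ^ (-((N : ℝ) * (p - 1) / 2)) * heatKernel N t (x - y) := by
          rw [← Real.rpow_mul ht.le]
          ring_nf
  refine (lintegral_mono hpt).trans_eq ?_
  rw [lintegral_const_mul _ (by fun_prop), lintegral_heatKernel_sub ht, mul_one,
    ENNReal.ofReal_rpow_of_nonneg (by positivity) (by linarith), ← Real.rpow_mul ht.le]
  congr 2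
  field_simp

lemma heatKernel_mul_heatKernel_sub {ρ σ : ℝ} (hρ : 0 < ρ) (hσ : 0 < σ) (x y : Space N) :
    heatKernel N ρ x * heatKernel N σ (x - y) =
      heatKernel N (ρ + σ) y * heatKernel N (ρ * σ / (ρ + σ)) (x - (ρ / (ρ + σ)) • y) := by
  have := Real.pi_pos
  have hx : ‖x - (ρ / (ρ + σ)) • y‖ ^ 2 =
      ‖x‖ ^ 2 - 2 * (ρ / (ρ + σ)) * inner ℝ x y + (ρ / (ρ + σ)) ^ 2 * ‖y‖ ^ 2 := by
    rw [norm_sub_sq_real, inner_smul_right, norm_smul, mul_pow, Real.norm_eq_abs, sq_abs]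
    ring
  simp only [heatKernel]
  rw [mul_mul_mul_comm, ← Real.exp_add, mul_mul_mul_comm, ← Real.exp_add, div_mul_div_comm,
    div_mul_div_comm, ← Real.mul_rpow (by positivity) (by positivity),
    ← Real.mul_rpow (by positivity) (by positivity), hx, norm_sub_sq_real]
  congr 1
  · congr 2
    field_simp
  · congr 1
    field_simp
    ring

lemma lintegral_heatKernel_mul_heatKernel_sub {ρ σ : ℝ} (hρ : 0 < ρ) (hσ : 0 < σ) (y : Space N) :
    ∫⁻ x, ENNReal.ofReal (heatKernel N ρ x) * ENNReal.ofReal (heatKernel N σ (x - y)) =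
      ENNReal.ofReal (heatKernel N (ρ + σ) y) := by
  simp only [← ENNReal.ofReal_mul (heatKernel_pos hρ _).le, heatKernel_mul_heatKernel_sub hρ hσ,
    ENNReal.ofReal_mul (heatKernel_pos (add_pos hρ hσ) _).le]
  rw [lintegral_const_mul _ (by fun_prop), lintegral_heatKernel_sub (by positivity), mul_one]

lemma lintegral_heatKernel_mul_heatFlow {ρ σ : ℝ} (hρ : 0 < ρ) (hσ : 0 < σ)
    (μ : Measure (Space N)) [SFinite μ] :
    ∫⁻ x, ENNReal.ofReal (heatKernel N ρ x) * heatFlow σ μ x =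
      ∫⁻ y, ENNReal.ofReal (heatKernel N (ρ + σ) y) ∂μ := by
  have hflow (x : Space N) : ENNReal.ofReal (heatKernel N ρ x) * heatFlow σ μ x =
      ∫⁻ y, ENNReal.ofReal (heatKernel N ρ x) * ENNReal.ofReal (heatKernel N σ (x - y)) ∂μ :=
    (lintegral_const_mul _ (by fun_prop)).symm
  simp only [hflow]
  rw [lintegral_lintegral_swap (by fun_prop)]
  exact lintegral_congr fun y => lintegral_heatKernel_mul_heatKernel_sub hρ hσ y

lemma rpow_div_mul_one_div_rpow {ρ σ : ℝ} (hρ : 0 < ρ) (hσ : 0 < σ) (s : ℝ) :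
    (ρ / σ) ^ s * (1 / (4 * Real.pi * ρ) ^ s) = 1 / (4 * Real.pi * σ) ^ s := by
  have := Real.pi_pos
  rw [Real.div_rpow hρ.le hσ.le, Real.mul_rpow (by positivity) hρ.le,
    Real.mul_rpow (by positivity) hσ.le]
  have := (Real.rpow_pos_of_pos hρ s).ne'
  field_simp

lemma mul_heatKernel_le_heatKernel_add {ρ σ : ℝ} (hρ : 0 < ρ) (hσ : 0 ≤ σ) (y : Space N) :
    (ρ / (ρ + σ)) ^ ((N : ℝ) / 2) * heatKernel N ρ y ≤ heatKernel N (ρ + σ) y := by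
  have hs : 0 < ρ + σ := by linarith
  rw [heatKernel, heatKernel, ← mul_assoc, rpow_div_mul_one_div_rpow hρ hs]
  gcongr 1 / _ * Real.exp ?_
  rw [div_le_div_iff₀ (by positivity) (by positivity)]
  nlinarith [mul_nonneg (sq_nonneg ‖y‖) hσ]

lemma heatKernel_le_mul_heatKernel_sub {ρ σ : ℝ} (hρ : 0 < ρ) (hσ : 2 * ρ ≤ σ) (x y : Space N) :
    heatKernel N ρ y ≤
      (σ / ρ) ^ ((N : ℝ) / 2) * Real.exp (‖x‖ ^ 2 / (2 * σ)) * heatKernel N σ (x - y) := by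
  have hs : 0 < σ := by linarith
  have hxy : ‖x - y‖ ^ 2 ≤ 2 * ‖x‖ ^ 2 + 2 * ‖y‖ ^ 2 := by
    have hpar := parallelogram_law_with_norm ℝ x y
    nlinarith [sq_nonneg ‖x + y‖]
  have hquot : ‖x - y‖ ^ 2 / (4 * σ) ≤ ‖x‖ ^ 2 / (2 * σ) + ‖y‖ ^ 2 / (4 * ρ) :=
    calc ‖x - y‖ ^ 2 / (4 * σ) ≤ (2 * ‖x‖ ^ 2 + 2 * ‖y‖ ^ 2) / (4 * σ) := by gcongr
      _ = ‖x‖ ^ 2 / (2 * σ) + ‖y‖ ^ 2 / (2 * σ) := by field_simp; ring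
      _ ≤ ‖x‖ ^ 2 / (2 * σ) + ‖y‖ ^ 2 / (4 * ρ) := by
          gcongr _ + _ / ?_
          linarith
  rw [heatKernel, heatKernel, mul_mul_mul_comm, ← Real.exp_add, rpow_div_mul_one_div_rpow hs hρ]
  gcongr 1 / _ * Real.exp ?_
  rw [neg_div, neg_div]
  linarith

end HeatKernel

/-! ### Subordinated heat flows -/

section SubordinatedFlow

variable {N : ℕ} {α t : ℝ} {w : ℝ → ℝ}

/-- The operator `∫_0^∞ w(θ) e^{t^α θ Δ} dθ`, which is `P_α(t)` for `w = h_α` and `S_α(t)` for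
`w(θ) = θ h_α(θ)`. -/
noncomputable def subordinatedFlow (w : ℝ → ℝ) (α t : ℝ) (μ : Measure (Space N)) (x : Space N) :
    ℝ≥0∞ :=
  ∫⁻ θ in Ioi (0 : ℝ), ENNReal.ofReal (w θ) * heatFlow (t ^ α * θ) μ x

/-- The convolution kernel of `subordinatedFlow w α t`. -/
noncomputable def subordinatedKernel (w : ℝ → ℝ) (α t : ℝ) (x : Space N) : ℝ≥0∞ :=
  ∫⁻ θ in Ioi (0 : ℝ), ENNReal.ofReal (w θ) * ENNReal.ofReal (heatKernel N (t ^ α * θ) x)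

lemma subordinatedFlow_mono {μ ν : Measure (Space N)} (h : μ ≤ ν) (x : Space N) :
    subordinatedFlow w α t μ x ≤ subordinatedFlow w α t ν x :=
  lintegral_mono fun _ => mul_le_mul_right (lintegral_mono' h le_rfl) _

section Measurability

variable {β : Type*} [MeasurableSpace β] {f : β → ℝ} {g : β → Space N}

lemma measurable_heatFlow (μ : Measure (Space N)) [SFinite μ] (hf : Measurable f)
    (hg : Measurable g) : Measurable fun b => heatFlow (f b) μ (g b) :=
  Measurable.lintegral_prod_right'
    (f := fun q : β × Space N => ENNReal.ofReal (heatKernel N (f q.1) (g q.1 - q.2)))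
    (by fun_prop)

lemma measurable_subordinatedKernel (hw : Measurable w) (hf : Measurable f) (hg : Measurable g) :
    Measurable fun b => subordinatedKernel w α (f b) (g b) :=
  Measurable.lintegral_prod_right' (f := fun q : β × ℝ =>
    ENNReal.ofReal (w q.2) * ENNReal.ofReal (heatKernel N (f q.1 ^ α * q.2) (g q.1)))
    (by fun_prop)

end Measurability

lemma subordinatedFlow_eq_lintegral (hw : Measurable w) (μ : Measure (Space N)) [SFinite μ]
    (x : Space N) :
    subordinatedFlow w α t μ x = ∫⁻ y, subordinatedKernel w α t (x - y) ∂μ := by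
  unfold subordinatedFlow subordinatedKernel heatFlow
  rw [lintegral_lintegral_swap (by fun_prop)]
  exact lintegral_congr fun θ => (lintegral_const_mul _ (by fun_prop)).symm

lemma subordinatedFlow_withDensity (hw : Measurable w) {f : Space N → ℝ≥0∞} (hf : Measurable f)
    (x : Space N) :
    subordinatedFlow w α t (volume.withDensity f) x =
      ∫⁻ y, f y * subordinatedKernel w α t (x - y) := by
  rw [subordinatedFlow_eq_lintegral hw, lintegral_withDensity_eq_lintegral_mul _ hf
    (measurable_subordinatedKernel hw (by fun_prop) (by fun_prop))]
  rfl

lemma measurable_subordinatedFlow {β : Type*} [MeasurableSpace β] {f : β → ℝ} {g : β → Space N}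
    (hw : Measurable w) (μ : Measure (Space N)) [SFinite μ] (hf : Measurable f)
    (hg : Measurable g) : Measurable fun b => subordinatedFlow w α (f b) μ (g b) := by
  simp only [subordinatedFlow_eq_lintegral hw]
  exact Measurable.lintegral_prod_right'
    (f := fun q : β × Space N => subordinatedKernel w α (f q.1) (g q.1 - q.2))
    (measurable_subordinatedKernel hw (by fun_prop) (by fun_prop))

lemma measurable_subordinatedFlow_withDensity {β : Type*} [MeasurableSpace β] {f : β → ℝ}
    {g : β → Space N} (hw : Measurable w) {v : β → Space N → ℝ≥0∞}
    (hv : Measurable (Function.uncurry v)) (hf : Measurable f) (hg : Measurable g) :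
    Measurable fun b => subordinatedFlow w α (f b) (volume.withDensity (v b)) (g b) := by
  simp only [subordinatedFlow_withDensity hw hv.of_uncurry_left]
  exact Measurable.lintegral_prod_right' (f := fun q : β × Space N =>
    Function.uncurry v q * subordinatedKernel w α (f q.1) (g q.1 - q.2))
    (hv.mul (measurable_subordinatedKernel hw (by fun_prop) (by fun_prop)))

lemma subordinatedFlow_withDensity_iSup (hw : Measurable w) {f : ℕ → Space N → ℝ≥0∞}
    (hf : ∀ n, Measurable (f n)) (hmono : Monotone f) (x : Space N) :
    subordinatedFlow w α t (volume.withDensity fun y => ⨆ n, f n y) x =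
      ⨆ n, subordinatedFlow w α t (volume.withDensity (f n)) x := by
  have hk : Measurable fun y => subordinatedKernel w α t (x - y) :=
    measurable_subordinatedKernel hw (by fun_prop) (by fun_prop)
  simp only [subordinatedFlow_withDensity hw (Measurable.iSup hf),
    subordinatedFlow_withDensity hw (hf _), ENNReal.iSup_mul]
  exact lintegral_iSup (fun n => (hf n).mul hk) fun m n hmn y => mul_le_mul_left (hmono hmn y) _

end SubordinatedFlow

/-! ### Picard iteration and minimal solutions -/

section Picard

variable {N : ℕ} {α p : ℝ}

/-- The integral `∫_0^t (t - s)^{α-1} S_α(t - s) u(s)^p ds` in the integral equation. -/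
noncomputable def sourceTerm (α p : ℝ) (u : ℝ → Space N → ℝ≥0∞) (t : ℝ) (x : Space N) : ℝ≥0∞ :=
  ∫⁻ s in Ioo 0 t, ENNReal.ofReal ((t - s) ^ (α - 1)) *
    solutionOpS α (t - s) (volume.withDensity fun y => u s y ^ p) x

lemma duhamel_eq_solutionOpP_add_sourceTerm (μ : Measure (Space N)) (u : ℝ → Space N → ℝ≥0∞)
    (t : ℝ) (x : Space N) :
    duhamel α p μ u t x = solutionOpP α t μ x + ENNReal.ofReal α * sourceTerm α p u t x := rfl

lemma measurable_solutionOpS_rpow (h0 : 0 < α) (h1 : α < 1) {u : ℝ → Space N → ℝ≥0∞}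
    (hu : Measurable (Function.uncurry u)) {β : Type*} [MeasurableSpace β] {f s : β → ℝ}
    {g : β → Space N} (hf : Measurable f) (hs : Measurable s) (hg : Measurable g) :
    Measurable fun b => solutionOpS α (f b) (volume.withDensity fun y => u (s b) y ^ p) (g b) := by
  have hw := measurable_wrightDensity h0 h1
  have : Measurable fun q : β × Space N => u (s q.1) q.2 :=
    hu.comp (by fun_prop : Measurable fun q : β × Space N => (s q.1, q.2))
  exact measurable_subordinatedFlow_withDensity (v := fun b y => u (s b) y ^ p) (by fun_prop)
    (by unfold Function.uncurry; fun_prop) hf hg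

lemma measurable_sourceTerm (h0 : 0 < α) (h1 : α < 1) {u : ℝ → Space N → ℝ≥0∞}
    (hu : Measurable (Function.uncurry u)) :
    Measurable (Function.uncurry (sourceTerm α p u)) := by
  have hF : Measurable fun q : (ℝ × Space N) × ℝ => ENNReal.ofReal ((q.1.1 - q.2) ^ (α - 1)) *
      solutionOpS α (q.1.1 - q.2) (volume.withDensity fun y => u q.2 y ^ p) q.1.2 :=
    Measurable.mul (by fun_prop)
      (measurable_solutionOpS_rpow h0 h1 hu (by fun_prop) (by fun_prop) (by fun_prop))
  have hset : MeasurableSet {q : (ℝ × Space N) × ℝ | q.2 ∈ Ioo 0 q.1.1} :=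
    (measurableSet_lt measurable_const measurable_snd).inter
      (measurableSet_lt measurable_snd (measurable_fst.comp measurable_fst))
  convert! (hF.indicator hset).lintegral_prod_right' (ν := volume) using 2 with z
  exact (lintegral_indicator measurableSet_Ioo _).symm

lemma measurable_duhamel (h0 : 0 < α) (h1 : α < 1) (μ : Measure (Space N)) [SFinite μ]
    {u : ℝ → Space N → ℝ≥0∞} (hu : Measurable (Function.uncurry u)) :
    Measurable (Function.uncurry (duhamel α p μ u)) :=
  (measurable_subordinatedFlow (measurable_wrightDensity h0 h1) μ measurable_fst
    measurable_snd).add ((measurable_sourceTerm h0 h1 hu).const_mul _)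

lemma sourceTerm_iSup (h0 : 0 < α) (h1 : α < 1) (hp : 0 < p) {u : ℕ → ℝ → Space N → ℝ≥0∞}
    (hu : ∀ n, Measurable (Function.uncurry (u n))) (hmono : Monotone u) (t : ℝ) (x : Space N) :
    sourceTerm α p (fun s y => ⨆ n, u n s y) t x = ⨆ n, sourceTerm α p (u n) t x := by
  have hw := measurable_wrightDensity h0 h1
  have hpow (s : ℝ) (y : Space N) : (⨆ n, u n s y) ^ p = ⨆ n, u n s y ^ p :=
    (ENNReal.orderIsoRpow p hp).map_iSup _
  have hmono' (s : ℝ) : Monotone fun n y => u n s y ^ p := fun m n hmn y =>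
    ENNReal.rpow_le_rpow (hmono hmn s y) hp.le
  have hS (s : ℝ) : solutionOpS α (t - s) (volume.withDensity fun y => (⨆ n, u n s y) ^ p) x =
      ⨆ n, solutionOpS α (t - s) (volume.withDensity fun y => u n s y ^ p) x := by
    simp only [hpow]
    exact subordinatedFlow_withDensity_iSup (by fun_prop)
      (fun n => (hu n).of_uncurry_left.pow_const p) (hmono' s) x
  simp only [sourceTerm, hS, ENNReal.mul_iSup]
  refine lintegral_iSup (fun n => Measurable.mul (by fun_prop)
    (measurable_solutionOpS_rpow h0 h1 (hu n) (by fun_prop) measurable_id measurable_const)) ?_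
  exact fun m n hmn s => mul_le_mul_right (subordinatedFlow_mono
    (withDensity_mono (Eventually.of_forall (hmono' s hmn))) x) _

lemma restrict_Ioc_prod_univ (T : ℝ) :
    (volume : Measure (ℝ × Space N)).restrict (Ioc 0 T ×ˢ univ) =
      (volume.restrict (Ioc 0 T)).prod volume := by
  rw [Measure.volume_eq_prod, ← Measure.prod_restrict, Measure.restrict_univ]

lemma duhamel_mono_ae (hp : 0 ≤ p) {μ ν : Measure (Space N)} (hμν : μ ≤ ν) {T : ℝ}
    {u v : ℝ → Space N → ℝ≥0∞}
    (h : ∀ᵐ z : ℝ × Space N ∂(volume.restrict (Ioc 0 T ×ˢ univ)), u z.1 z.2 ≤ v z.1 z.2)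
    {t : ℝ} (ht : t ≤ T) (x : Space N) : duhamel α p μ u t x ≤ duhamel α p ν v t x := by
  rw [restrict_Ioc_prod_univ] at h
  have hsub : Ioo 0 t ⊆ Ioc 0 T := fun s hs => ⟨hs.1, hs.2.le.trans ht⟩
  refine add_le_add (subordinatedFlow_mono hμν x) (mul_le_mul_right (lintegral_mono_ae ?_) _)
  filter_upwards [ae_restrict_of_ae_restrict_of_subset hsub (Measure.ae_ae_of_ae_prod h)] with s hs
  refine mul_le_mul_right (subordinatedFlow_mono (withDensity_mono ?_) x) _
  filter_upwards [hs] with y hy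
  gcongr

/-- The Picard iterates of the integral equation, starting from `0`. -/
noncomputable def picard (α p : ℝ) (μ : Measure (Space N)) : ℕ → ℝ → Space N → ℝ≥0∞
  | 0 => 0
  | n + 1 => duhamel α p μ (picard α p μ n)

/-- The pointwise limit of the increasing sequence of Picard iterates; where it is finite almost
everywhere, it is the minimal solution. -/
noncomputable def picardLimit (α p : ℝ) (μ : Measure (Space N)) (t : ℝ) (x : Space N) : ℝ≥0∞ :=
  ⨆ n, picard α p μ n t x

lemma measurable_picard (h0 : 0 < α) (h1 : α < 1) (μ : Measure (Space N)) [SFinite μ] (n : ℕ) :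
    Measurable (Function.uncurry (picard α p μ n)) := by
  induction n with
  | zero => exact measurable_const
  | succ n ih => exact measurable_duhamel h0 h1 μ ih

lemma measurable_picardLimit (h0 : 0 < α) (h1 : α < 1) (μ : Measure (Space N)) [SFinite μ] :
    Measurable (Function.uncurry (picardLimit α p μ)) :=
  Measurable.iSup fun n => measurable_picard h0 h1 μ n

lemma monotone_picard (hp : 0 ≤ p) (μ : Measure (Space N)) : Monotone (picard α p μ) := by
  refine monotone_nat_of_le_succ fun n => ?_
  induction n with
  | zero => exact fun _ _ => zero_le
  | succ n ih =>
    exact fun t x => duhamel_mono_ae hp le_rfl (Eventually.of_forall fun z => ih z.1 z.2) le_rfl x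

lemma picardLimit_eq_duhamel (h0 : 0 < α) (h1 : α < 1) (hp : 0 < p) (μ : Measure (Space N))
    [SFinite μ] (t : ℝ) (x : Space N) :
    picardLimit α p μ t x = duhamel α p μ (picardLimit α p μ) t x := by
  have hmono := monotone_picard (α := α) hp.le μ
  have hmono' : Monotone fun n => picard α p μ n t x := fun _ _ hmn => hmono hmn t x
  calc picardLimit α p μ t x = ⨆ n, picard α p μ (n + 1) t x := (hmono'.iSup_nat_add 1).symm
    _ = solutionOpP α t μ x + ENNReal.ofReal α * ⨆ n, sourceTerm α p (picard α p μ n) t x := by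
        rw [ENNReal.mul_iSup, ENNReal.add_iSup]
        rfl
    _ = duhamel α p μ (picardLimit α p μ) t x := by
        rw [← sourceTerm_iSup h0 h1 hp (measurable_picard h0 h1 μ) hmono]
        rfl

lemma picardLimit_le_of_supersolution (hp : 0 ≤ p) {μ ν : Measure (Space N)} (hμν : μ ≤ ν) {T : ℝ}
    {v : ℝ → Space N → ℝ≥0∞}
    (h : ∀ᵐ z : ℝ × Space N ∂(volume.restrict (Ioc 0 T ×ˢ univ)),
      duhamel α p ν v z.1 z.2 ≤ v z.1 z.2) :
    ∀ᵐ z : ℝ × Space N ∂(volume.restrict (Ioc 0 T ×ˢ univ)),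
      picardLimit α p μ z.1 z.2 ≤ v z.1 z.2 := by
  have key : ∀ n, ∀ᵐ z : ℝ × Space N ∂(volume.restrict (Ioc 0 T ×ˢ univ)),
      picard α p μ n z.1 z.2 ≤ v z.1 z.2 := by
    intro n
    induction n with
    | zero => exact Eventually.of_forall fun _ => zero_le
    | succ n ih =>
      filter_upwards [h, ae_restrict_mem (measurableSet_Ioc.prod MeasurableSet.univ)] with z hz hzT
      exact (duhamel_mono_ae hp hμν ih hzT.1.2 z.2).trans hz
  filter_upwards [ae_all_iff.2 key] with z hz
  exact iSup_le hz

lemma isMinimalSolution_picardLimit (h0 : 0 < α) (h1 : α < 1) (hp : 0 < p) (μ : Measure (Space N))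
    [SFinite μ] {T : ℝ}
    (h : ∀ᵐ z : ℝ × Space N ∂(volume.restrict (Ioc 0 T ×ˢ univ)),
      picardLimit α p μ z.1 z.2 < ∞) :
    IsMinimalSolution α p μ T (picardLimit α p μ) := by
  refine ⟨⟨(measurable_picardLimit h0 h1 μ).aemeasurable, ?_⟩, fun v hv => ?_⟩
  · filter_upwards [h] with z hz
    exact ⟨hz, picardLimit_eq_duhamel h0 h1 hp μ _ _⟩
  · refine picardLimit_le_of_supersolution hp.le le_rfl ?_
    filter_upwards [hv.eq_duhamel] with z hz
    exact hz.2.ge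

lemma IsSolution.picardLimit_lt_top (hp : 0 ≤ p) {μ ν : Measure (Space N)} (hμν : μ ≤ ν) {T : ℝ}
    {v : ℝ → Space N → ℝ≥0∞} (hv : IsSolution α p ν T v) :
    ∀ᵐ z : ℝ × Space N ∂(volume.restrict (Ioc 0 T ×ˢ univ)), picardLimit α p μ z.1 z.2 < ∞ := by
  have hsuper : ∀ᵐ z : ℝ × Space N ∂(volume.restrict (Ioc 0 T ×ˢ univ)),
      duhamel α p ν v z.1 z.2 ≤ v z.1 z.2 := by
    filter_upwards [hv.eq_duhamel] with z hz
    exact hz.2.ge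
  filter_upwards [hv.eq_duhamel, picardLimit_le_of_supersolution hp hμν hsuper] with z hz hle
  exact hle.trans_lt hz.1

end Picard

/-! ### Integral inequalities -/

section IntegralInequalities

lemma rpow_lintegral_le_mul_rpow_lintegral {Z : Type*} [MeasurableSpace Z] {ν : Measure Z}
    {p : ℝ} (hp : 1 < p) {f w : Z → ℝ≥0∞} (hf : Measurable f) (hw : Measurable w)
    (h : ∀ᵐ z ∂ν, w z ≠ 0 ∧ w z ≠ ∞) :
    (∫⁻ z, f z ∂ν) ^ p ≤ (∫⁻ z, f z ^ p * w z ^ (1 - p) ∂ν) * (∫⁻ z, w z ∂ν) ^ (p - 1) := by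
  have hp0 : 0 < p := by linarith
  set q := p.conjExponent
  have hpq : p.HolderConjugate q := Real.HolderConjugate.conjExponent hp
  have hsplit : ∫⁻ z, f z ∂ν = ∫⁻ z, ((fun z => f z * w z ^ (-q⁻¹)) * fun z => w z ^ q⁻¹) z ∂ν := by
    refine lintegral_congr_ae ?_
    filter_upwards [h] with z hz
    rw [Pi.mul_apply, mul_assoc, ← ENNReal.rpow_add _ _ hz.1 hz.2, neg_add_cancel,
      ENNReal.rpow_zero, mul_one]
  have hfst (z : Z) : (f z * w z ^ (-q⁻¹)) ^ p = f z ^ p * w z ^ (1 - p) := by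
    rw [ENNReal.mul_rpow_of_nonneg _ _ hp0.le, ← ENNReal.rpow_mul, neg_mul, inv_mul_eq_div,
      hpq.div_conj_eq_sub_one, neg_sub]
  have hsnd (z : Z) : (w z ^ q⁻¹) ^ q = w z := ENNReal.rpow_inv_rpow hpq.symm.ne_zero _
  have hHolder := ENNReal.lintegral_mul_le_Lp_mul_Lq ν hpq (f := fun z => f z * w z ^ (-q⁻¹))
    (g := fun z => w z ^ q⁻¹) (by fun_prop) (by fun_prop)
  rw [← hsplit] at hHolder
  simp only [hfst, hsnd] at hHolder
  calc (∫⁻ z, f z ∂ν) ^ p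
      ≤ ((∫⁻ z, f z ^ p * w z ^ (1 - p) ∂ν) ^ (1 / p) * (∫⁻ z, w z ∂ν) ^ (1 / q)) ^ p := by
        gcongr
    _ = _ := by
        rw [ENNReal.mul_rpow_of_nonneg _ _ hp0.le, ← ENNReal.rpow_mul, ← ENNReal.rpow_mul,
          one_div_mul_cancel hp0.ne', ENNReal.rpow_one, one_div_mul_eq_div,
          hpq.div_conj_eq_sub_one]

/-- **Minkowski's integral inequality**, with `A z` a bound for the `L^p` norm of `g z`. -/
lemma lintegral_rpow_lintegral_le {Z X : Type*} [MeasurableSpace Z] [MeasurableSpace X]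
    {ν : Measure Z} {μ : Measure X} [SFinite ν] [SFinite μ] {p : ℝ} (hp : 1 < p)
    {g : Z → X → ℝ≥0∞} (hg : Measurable (Function.uncurry g)) {A : Z → ℝ≥0∞} (hA : Measurable A)
    (h : ∀ᵐ z ∂ν, A z ≠ 0 ∧ A z ≠ ∞ ∧ ∫⁻ x, g z x ^ p ∂μ ≤ A z ^ p) :
    ∫⁻ x, (∫⁻ z, g z x ∂ν) ^ p ∂μ ≤ (∫⁻ z, A z ∂ν) ^ p := by
  have hswap : Measurable fun y : X × Z => g y.2 y.1 ^ p * A y.2 ^ (1 - p) := by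
    have : Measurable fun y : X × Z => g y.2 y.1 := hg.comp measurable_swap
    fun_prop
  have hweight : ∀ᵐ z ∂ν, ∫⁻ x, g z x ^ p * A z ^ (1 - p) ∂μ ≤ A z := by
    filter_upwards [h] with z ⟨h0, htop, hle⟩
    rw [lintegral_mul_const _ (hg.of_uncurry_left.pow_const p)]
    calc _ ≤ A z ^ p * A z ^ (1 - p) := by gcongr
      _ = A z := by rw [← ENNReal.rpow_add _ _ h0 htop, add_sub_cancel, ENNReal.rpow_one]
  calc ∫⁻ x, (∫⁻ z, g z x ∂ν) ^ p ∂μ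
      ≤ ∫⁻ x, (∫⁻ z, g z x ^ p * A z ^ (1 - p) ∂ν) * (∫⁻ z, A z ∂ν) ^ (p - 1) ∂μ :=
        lintegral_mono fun x => rpow_lintegral_le_mul_rpow_lintegral hp hg.of_uncurry_right hA
          (h.mono fun z hz => ⟨hz.1, hz.2.1⟩)
    _ = (∫⁻ z, ∫⁻ x, g z x ^ p * A z ^ (1 - p) ∂μ ∂ν) * (∫⁻ z, A z ∂ν) ^ (p - 1) := by
        rw [lintegral_mul_const _ hswap.lintegral_prod_right',
          lintegral_lintegral_swap hswap.aemeasurable]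
    _ ≤ (∫⁻ z, A z ∂ν) * (∫⁻ z, A z ∂ν) ^ (p - 1) := by
        gcongr ?_ * _
        exact lintegral_mono_ae hweight
    _ = (∫⁻ z, A z ∂ν) ^ p := by
        nth_rewrite 1 [← ENNReal.rpow_one (∫⁻ z, A z ∂ν)]
        rw [← ENNReal.rpow_add_of_nonneg _ _ zero_le_one (by linarith), add_sub_cancel]

lemma lintegral_add_rpow_le {X : Type*} [MeasurableSpace X] {μ : Measure X} {p : ℝ} (hp : 1 ≤ p)
    {f g : X → ℝ≥0∞} (hf : Measurable f) (hg : Measurable g) {A B : ℝ≥0∞}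
    (hA : ∫⁻ x, f x ^ p ∂μ ≤ A ^ p) (hB : ∫⁻ x, g x ^ p ∂μ ≤ B ^ p) :
    ∫⁻ x, (f x + g x) ^ p ∂μ ≤ (A + B) ^ p := by
  have hp0 : 0 < p := by linarith
  have h := ENNReal.lintegral_Lp_add_le hf.aemeasurable hg.aemeasurable (μ := μ) hp
  simp only [one_div] at h
  exact (ENNReal.rpow_inv_le_iff hp0).1 (h.trans (add_le_add
    ((ENNReal.rpow_inv_le_iff hp0).2 hA) ((ENNReal.rpow_inv_le_iff hp0).2 hB)))

lemma lintegral_Ioo_rpow {t r : ℝ} (ht : 0 < t) (hr : -1 < r) :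
    ∫⁻ s in Ioo 0 t, ENNReal.ofReal (s ^ r) = ENNReal.ofReal (t ^ (r + 1) / (r + 1)) := by
  have hi : IntegrableOn (fun s : ℝ => s ^ r) (Ioo 0 t) :=
    (intervalIntegral.integrableOn_Ioo_rpow_iff ht).2 hr
  have hnonneg : 0 ≤ᵐ[volume.restrict (Ioo 0 t)] fun s => s ^ r :=
    (ae_restrict_iff' measurableSet_Ioo).2
      (Eventually.of_forall fun s hs => Real.rpow_nonneg hs.1.le r)
  rw [← ofReal_integral_eq_lintegral_ofReal hi hnonneg, ← integral_Ioc_eq_integral_Ioo,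
    ← intervalIntegral.integral_of_le ht.le, integral_rpow (Or.inl hr),
    Real.zero_rpow (by linarith), sub_zero]

lemma lintegral_Ioo_sub_rpow {t r : ℝ} (ht : 0 < t) (hr : -1 < r) :
    ∫⁻ s in Ioo 0 t, ENNReal.ofReal ((t - s) ^ r) = ENNReal.ofReal (t ^ (r + 1) / (r + 1)) := by
  rw [← lintegral_Ioo_rpow ht hr, ← lintegral_indicator measurableSet_Ioo,
    ← lintegral_indicator measurableSet_Ioo, ← lintegral_sub_left_eq_self _ t]
  refine lintegral_congr fun s => ?_
  have hmem : t - s ∈ Ioo 0 t ↔ s ∈ Ioo 0 t := by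
    constructor <;> rintro ⟨h0, h1⟩ <;> constructor <;> linarith
  simp only [indicator_apply, hmem, sub_sub_cancel]

lemma mul_rpow_le_add_of_mem_Ioo {t a b s : ℝ} (ha : a ≤ 1) (hb : 0 ≤ b) (hs : s ∈ Ioo 0 t) :
    (t - s) ^ (a - 1) * s ^ (-b) ≤
      (t / 2) ^ (a - 1) * s ^ (-b) + (t / 2) ^ (-b) * (t - s) ^ (a - 1) := by
  have hs0 : 0 < s := hs.1
  have hst : 0 < t - s := sub_pos.2 hs.2
  have ht : 0 < t := by linarith
  rcases le_total s (t / 2) with h | h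
  · refine le_add_of_le_of_nonneg ?_ (by positivity)
    gcongr ?_ * _
    exact Real.rpow_le_rpow_of_nonpos (by positivity) (by linarith) (by linarith)
  · refine le_add_of_nonneg_of_le (by positivity) ?_
    rw [mul_comm]
    gcongr ?_ * _
    exact Real.rpow_le_rpow_of_nonpos (by positivity) h (by linarith)

lemma half_rpow_neg_mul_rpow_le {t b : ℝ} (ht : 0 < t) (hb : b ≤ 1) (c : ℝ) :
    (t / 2) ^ (-b) * t ^ c ≤ 2 * t ^ (c - b) := by
  have h2 : (2 : ℝ) ^ b ≤ 2 := by
    simpa using Real.rpow_le_rpow_of_exponent_le (one_le_two : (1 : ℝ) ≤ 2) hb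
  calc (t / 2) ^ (-b) * t ^ c = 2 ^ b * t ^ (c - b) := by
        rw [Real.div_rpow ht.le two_pos.le, Real.rpow_neg two_pos.le, div_inv_eq_mul,
          mul_right_comm, mul_comm, ← Real.rpow_add ht, neg_add_eq_sub]
    _ ≤ 2 * t ^ (c - b) := by gcongr

lemma lintegral_beta_le {t a b : ℝ} (ht : 0 < t) (ha : 0 < a) (ha1 : a ≤ 1) (hb0 : 0 ≤ b)
    (hb : b < 1) :
    ∫⁻ s in Ioo 0 t, ENNReal.ofReal ((t - s) ^ (a - 1) * s ^ (-b)) ≤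
      ENNReal.ofReal (2 * (1 / (1 - b) + 1 / a) * t ^ (a - b)) := by
  have := sub_pos.2 hb
  have hfst := half_rpow_neg_mul_rpow_le ht (b := 1 - a) (by linarith) (1 - b)
  have hsnd := half_rpow_neg_mul_rpow_le ht hb.le a
  rw [neg_sub, show 1 - b - (1 - a) = a - b by ring] at hfst
  calc _ ≤ ∫⁻ s in Ioo 0 t, (ENNReal.ofReal ((t / 2) ^ (a - 1)) * ENNReal.ofReal (s ^ (-b)) +
          ENNReal.ofReal ((t / 2) ^ (-b)) * ENNReal.ofReal ((t - s) ^ (a - 1))) := by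
        refine setLIntegral_mono' measurableSet_Ioo fun s hs => ?_
        have := hs.1
        have := Real.rpow_nonneg (sub_pos.2 hs.2).le (a - 1)
        rw [← ENNReal.ofReal_mul (by positivity), ← ENNReal.ofReal_mul (by positivity),
          ← ENNReal.ofReal_add (by positivity) (by positivity)]
        exact ENNReal.ofReal_le_ofReal (mul_rpow_le_add_of_mem_Ioo ha1 hb0 hs)
    _ = ENNReal.ofReal ((t / 2) ^ (a - 1) * (t ^ (1 - b) / (1 - b)) +
          (t / 2) ^ (-b) * (t ^ a / a)) := by
        rw [lintegral_add_left (by fun_prop), lintegral_const_mul _ (by fun_prop),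
          lintegral_const_mul _ (by fun_prop), lintegral_Ioo_rpow ht (by linarith),
          lintegral_Ioo_sub_rpow ht (by linarith), neg_add_eq_sub, sub_add_cancel,
          ← ENNReal.ofReal_mul (by positivity), ← ENNReal.ofReal_mul (by positivity),
          ← ENNReal.ofReal_add (by positivity) (by positivity)]
    _ ≤ _ := by
        refine ENNReal.ofReal_le_ofReal ?_
        calc _ = (t / 2) ^ (a - 1) * t ^ (1 - b) / (1 - b) + (t / 2) ^ (-b) * t ^ a / a := by ring
          _ ≤ 2 * t ^ (a - b) / (1 - b) + 2 * t ^ (a - b) / a := by gcongr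
          _ = _ := by ring

end IntegralInequalities

/-! ### Smoothing estimates and existence for small mass -/

section SmallMass

variable {N : ℕ} {α p : ℝ}

instance (N : ℕ) (κ : ℝ) : SFinite (diracMass N κ) := by unfold diracMass; infer_instance

/-- The ratio `(p - 1) / (p_F - 1) = N (p - 1) / 2`: it is less than, equal to or greater than `1`
according to whether `p` is subcritical, critical or supercritical. -/
noncomputable def fujitaRatio (N : ℕ) (p : ℝ) : ℝ := N * (p - 1) / 2

/-- The exponent in the decay `t ^ (-decayExponent N p)` of the `L^p` norm of the heat kernel. -/
noncomputable def decayExponent (N : ℕ) (p : ℝ) : ℝ := N * (p - 1) / (2 * p)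

lemma decayExponent_mul (hp : p ≠ 0) : decayExponent N p * p = fujitaRatio N p := by
  unfold decayExponent fujitaRatio
  field_simp

lemma fujitaRatio_nonneg (hp : 1 ≤ p) : 0 ≤ fujitaRatio N p := by
  have := sub_nonneg.2 hp
  unfold fujitaRatio
  positivity

lemma decayExponent_pos (hN : 1 ≤ N) (hp : 1 < p) : 0 < decayExponent N p := by
  have := sub_pos.2 hp
  unfold decayExponent
  positivity

lemma decayExponent_lt_one (hp : 1 < p) (h : fujitaRatio N p ≤ 1) : decayExponent N p < 1 := by
  rw [← decayExponent_mul (by linarith)] at h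
  by_contra! hc
  nlinarith

lemma lintegral_heatFlow_rpow_le (hp : 1 < p) {σ : ℝ} (hσ : 0 < σ) (μ : Measure (Space N))
    [SFinite μ] :
    ∫⁻ x, heatFlow σ μ x ^ p ≤ (ENNReal.ofReal (σ ^ (-decayExponent N p)) * μ univ) ^ p := by
  have h := lintegral_rpow_lintegral_le (ν := μ) (μ := volume) hp
    (g := fun y x : Space N => ENNReal.ofReal (heatKernel N σ (x - y)))
    (A := fun _ => ENNReal.ofReal (σ ^ (-decayExponent N p))) (by unfold Function.uncurry; fun_prop)
    measurable_const (Eventually.of_forall fun y => ⟨(ENNReal.ofReal_pos.2 (by positivity)).ne',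
      ENNReal.ofReal_ne_top, lintegral_heatKernel_sub_rpow_le hσ hp.le y⟩)
  rwa [lintegral_const] at h

lemma lintegral_subordinatedFlow_rpow_le (hp : 1 < p) {t : ℝ} (ht : 0 < t)
    (μ : Measure (Space N)) [SFinite μ] {m : ℝ≥0∞} (hm0 : m ≠ 0) (hm : m ≠ ∞) (hμ : μ univ ≤ m)
    {w : ℝ → ℝ} (hw : Measurable w) {C : ℝ}
    (hC : ∫⁻ θ in Ioi (0 : ℝ), ENNReal.ofReal (θ ^ (-decayExponent N p) * w θ) ≤
      ENNReal.ofReal C) :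
    ∫⁻ x, subordinatedFlow w α t μ x ^ p ≤
      (ENNReal.ofReal (t ^ (-(α * decayExponent N p)) * C) * m) ^ p := by
  set γ := decayExponent N p
  have hwm : Measurable fun θ => ENNReal.ofReal (w θ) := by fun_prop
  let ν : Measure ℝ := (volume.restrict (Ioi 0)).withDensity fun θ => ENNReal.ofReal (w θ)
  have hA : Measurable fun θ : ℝ => ENNReal.ofReal ((t ^ α * θ) ^ (-γ)) * m := by fun_prop
  have hflow (x : Space N) : subordinatedFlow w α t μ x = ∫⁻ θ, heatFlow (t ^ α * θ) μ x ∂ν := by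
    rw [lintegral_withDensity_eq_lintegral_mul _ hwm
      (measurable_heatFlow μ (by fun_prop) (by fun_prop))]
    rfl
  have hbound : ∀ᵐ θ ∂ν, ENNReal.ofReal ((t ^ α * θ) ^ (-γ)) * m ≠ 0 ∧
      ENNReal.ofReal ((t ^ α * θ) ^ (-γ)) * m ≠ ∞ ∧
      ∫⁻ x, heatFlow (t ^ α * θ) μ x ^ p ≤ (ENNReal.ofReal ((t ^ α * θ) ^ (-γ)) * m) ^ p := by
    refine (withDensity_absolutelyContinuous _ _).ae_le ?_
    filter_upwards [ae_restrict_mem measurableSet_Ioi] with θ (hθ : 0 < θ)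
    have hpos : 0 < (t ^ α * θ) ^ (-γ) := by positivity
    refine ⟨mul_ne_zero (ENNReal.ofReal_pos.2 hpos).ne' hm0, by finiteness, ?_⟩
    exact (lintegral_heatFlow_rpow_le hp (by positivity) μ).trans (by gcongr)
  simp only [hflow]
  refine (lintegral_rpow_lintegral_le hp (measurable_heatFlow μ (by fun_prop) (by fun_prop)) hA
    hbound).trans ?_
  gcongr
  calc _ = ∫⁻ θ in Ioi (0 : ℝ), ENNReal.ofReal (t ^ (-(α * γ))) * m *
        ENNReal.ofReal (θ ^ (-γ) * w θ) := by
        rw [lintegral_withDensity_eq_lintegral_mul _ hwm hA]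
        refine setLIntegral_congr_fun measurableSet_Ioi fun θ (hθ : 0 < θ) => ?_
        rw [Pi.mul_apply, Real.mul_rpow (by positivity) hθ.le, ← Real.rpow_mul ht.le, mul_neg,
          ENNReal.ofReal_mul (by positivity), ENNReal.ofReal_mul (by positivity)]
        ring
    _ = ENNReal.ofReal (t ^ (-(α * γ))) * m *
        ∫⁻ θ in Ioi (0 : ℝ), ENNReal.ofReal (θ ^ (-γ) * w θ) := lintegral_const_mul _ (by fun_prop)
    _ ≤ ENNReal.ofReal (t ^ (-(α * γ))) * m * ENNReal.ofReal C := by gcongr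
    _ = _ := by rw [ENNReal.ofReal_mul (by positivity)]; ring

lemma lintegral_solutionOpP_diracMass_rpow_le (h0 : 0 < α) (h1 : α < 1) (hN : 1 ≤ N) (hp : 1 < p)
    (hr : fujitaRatio N p ≤ 1) {κ t : ℝ} (hκ : 0 < κ) (ht : 0 < t) :
    ∫⁻ x, solutionOpP α t (diracMass N κ) x ^ p ≤ ENNReal.ofReal
      (κ * Real.Gamma (1 - decayExponent N p) * t ^ (-(α * decayExponent N p))) ^ p := by
  have hγ1 := decayExponent_lt_one hp hr
  have := Real.Gamma_pos_of_pos (sub_pos.2 hγ1)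
  refine (lintegral_subordinatedFlow_rpow_le hp ht (diracMass N κ)
    (ENNReal.ofReal_pos.2 hκ).ne' ENNReal.ofReal_ne_top (by simp [diracMass])
    (measurable_wrightDensity h0 h1)
    (lintegral_rpow_neg_mul_wrightDensity_le h0 h1 (decayExponent_pos hN hp) hγ1)).trans_eq ?_
  rw [← ENNReal.ofReal_mul (by positivity)]
  ring_nf

lemma lintegral_solutionOpS_rpow_le (h0 : 0 < α) (h1 : α < 1) (hN : 1 ≤ N) (hp : 1 < p)
    (hr : fujitaRatio N p ≤ 1) {t M : ℝ} (ht : 0 < t) (hM : 0 < M) {f : Space N → ℝ≥0∞}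
    (hf : ∫⁻ x, f x ≤ ENNReal.ofReal M) :
    ∫⁻ x, solutionOpS α t (volume.withDensity f) x ^ p ≤
      ENNReal.ofReal (2 * M * t ^ (-(α * decayExponent N p))) ^ p := by
  have := measurable_wrightDensity h0 h1
  have hmass : volume.withDensity f univ ≤ ENNReal.ofReal M := by
    rwa [withDensity_apply _ MeasurableSet.univ, Measure.restrict_univ]
  refine (lintegral_subordinatedFlow_rpow_le (w := fun θ => θ * wrightDensity α θ) hp ht _
    (ENNReal.ofReal_pos.2 hM).ne' ENNReal.ofReal_ne_top hmass (by fun_prop)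
    (lintegral_rpow_neg_mul_id_mul_wrightDensity_le h0 h1 (decayExponent_pos hN hp).le
      (decayExponent_lt_one hp hr))).trans_eq ?_
  rw [← ENNReal.ofReal_mul (by positivity)]
  ring_nf

/-- The constant in the `L^p` estimate of the source term; the two summands come from the
singularities of `(t - s) ^ (α (1 - γ) - 1) * s ^ (-α γ p)`, `γ = decayExponent N p`, at `s = 0` and
at `s = t`. -/
noncomputable def sourceConst (N : ℕ) (p α : ℝ) : ℝ :=
  4 * (1 / (1 - α * fujitaRatio N p) + 1 / (α * (1 - decayExponent N p)))

lemma sourceConst_pos (h0 : 0 < α) (h1 : α < 1) (hp : 1 < p) (hr : fujitaRatio N p ≤ 1) :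
    0 < sourceConst N p α := by
  have := fujitaRatio_nonneg (N := N) hp.le
  have : 0 < 1 - α * fujitaRatio N p := by nlinarith
  have : 0 < 1 - decayExponent N p := sub_pos.2 (decayExponent_lt_one hp hr)
  unfold sourceConst
  positivity

lemma lintegral_rpow_mul_solutionOpS_rpow_le (h0 : 0 < α) (h1 : α < 1) (hN : 1 ≤ N) (hp : 1 < p)
    (hr : fujitaRatio N p ≤ 1) {s t M : ℝ} (hs : s ∈ Ioo 0 t) (hM : 0 < M)
    {f : Space N → ℝ≥0∞}
    (h : ∫⁻ x, f x ^ p ≤ ENNReal.ofReal (M * s ^ (-(α * decayExponent N p))) ^ p) :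
    ∫⁻ x, (ENNReal.ofReal ((t - s) ^ (α - 1)) *
      solutionOpS α (t - s) (volume.withDensity fun y => f y ^ p) x) ^ p ≤
      ENNReal.ofReal (2 * M ^ p * ((t - s) ^ (α * (1 - decayExponent N p) - 1) *
        s ^ (-(α * fujitaRatio N p)))) ^ p := by
  have hp0 : 0 < p := by linarith
  have hmul := decayExponent_mul (N := N) hp0.ne'
  have hs0 : 0 < s := hs.1
  have hts : 0 < t - s := sub_pos.2 hs.2
  have := measurable_wrightDensity h0 h1
  set γ := decayExponent N p
  set r := fujitaRatio N p
  have hmass : ∫⁻ x, f x ^ p ≤ ENNReal.ofReal (M ^ p * s ^ (-(α * r))) := by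
    refine h.trans_eq ?_
    rw [ENNReal.ofReal_rpow_of_nonneg (by positivity) hp0.le, Real.mul_rpow hM.le (by positivity),
      ← Real.rpow_mul hs0.le, ← hmul]
    ring_nf
  have hSm : Measurable fun x => solutionOpS α (t - s) (volume.withDensity fun y => f y ^ p) x :=
    measurable_subordinatedFlow (by fun_prop) _ measurable_const measurable_id
  simp only [ENNReal.mul_rpow_of_nonneg _ _ hp0.le]
  rw [lintegral_const_mul _ (hSm.pow_const p)]
  calc _ ≤ ENNReal.ofReal ((t - s) ^ (α - 1)) ^ p * ENNReal.ofReal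
        (2 * (M ^ p * s ^ (-(α * r))) * (t - s) ^ (-(α * γ))) ^ p := by
        gcongr
        exact lintegral_solutionOpS_rpow_le h0 h1 hN hp hr hts (by positivity) hmass
    _ = _ := by
        rw [← ENNReal.mul_rpow_of_nonneg _ _ hp0.le, ← ENNReal.ofReal_mul (by positivity),
          show α * (1 - γ) - 1 = (α - 1) + -(α * γ) by ring, Real.rpow_add hts]
        ring_nf

lemma lintegral_sourceTerm_rpow_le (h0 : 0 < α) (h1 : α < 1) (hN : 1 ≤ N) (hp : 1 < p)
    (hr : fujitaRatio N p ≤ 1) {t M : ℝ} (ht : 0 < t) (hM : 0 < M)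
    {u : ℝ → Space N → ℝ≥0∞} (hu : Measurable (Function.uncurry u))
    (h : ∀ s ∈ Ioo 0 t,
      ∫⁻ x, u s x ^ p ≤ ENNReal.ofReal (M * s ^ (-(α * decayExponent N p))) ^ p) :
    ∫⁻ x, sourceTerm α p u t x ^ p ≤ ENNReal.ofReal (sourceConst N p α * M ^ p *
      t ^ (α * (1 - fujitaRatio N p)) * t ^ (-(α * decayExponent N p))) ^ p := by
  have hγ0 := decayExponent_pos hN hp
  have hγ1 := decayExponent_lt_one hp hr
  have hr0 := fujitaRatio_nonneg (N := N) hp.le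
  have hS : ∀ᵐ s ∂volume.restrict (Ioo 0 t), _ := (ae_restrict_iff' measurableSet_Ioo).2
    (Eventually.of_forall fun s hs => lintegral_rpow_mul_solutionOpS_rpow_le (f := u s) h0 h1 hN hp
      hr hs hM (h s hs))
  have hSm : Measurable (Function.uncurry fun s x => ENNReal.ofReal ((t - s) ^ (α - 1)) *
      solutionOpS α (t - s) (volume.withDensity fun y => u s y ^ p) x) :=
    Measurable.mul (by fun_prop)
      (measurable_solutionOpS_rpow h0 h1 hu (by fun_prop) measurable_fst measurable_snd)
  refine (lintegral_rpow_lintegral_le hp hSm (A := fun s => ENNReal.ofReal (2 * M ^ p *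
    ((t - s) ^ (α * (1 - decayExponent N p) - 1) * s ^ (-(α * fujitaRatio N p)))))
    (by fun_prop) ?_).trans ?_
  · filter_upwards [ae_restrict_mem measurableSet_Ioo, hS] with s hs hle
    have := hs.1
    have := sub_pos.2 hs.2
    exact ⟨(ENNReal.ofReal_pos.2 (by positivity)).ne', ENNReal.ofReal_ne_top, hle⟩
  gcongr
  simp only [ENNReal.ofReal_mul (by positivity : 0 ≤ 2 * M ^ p)]
  rw [lintegral_const_mul _ (by fun_prop)]
  calc _ ≤ ENNReal.ofReal (2 * M ^ p) * ENNReal.ofReal _ :=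
        mul_le_mul_right (lintegral_beta_le ht (mul_pos h0 (by linarith)) (by nlinarith)
          (by positivity) (by nlinarith)) _
    _ = _ := by
        rw [← ENNReal.ofReal_mul (by positivity), mul_assoc _ (t ^ _), ← Real.rpow_add ht]
        unfold sourceConst
        ring_nf

/-- The condition on `κ` and `T` makes a weighted ball of `L^p` invariant under the Picard
iteration. -/
lemma lintegral_picard_rpow_le (h0 : 0 < α) (h1 : α < 1) (hN : 1 ≤ N) (hp : 1 < p)
    (hr : fujitaRatio N p ≤ 1) {κ T Γ : ℝ} (hκ : 0 < κ)
    (hΓ : Γ = Real.Gamma (1 - decayExponent N p))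
    (hsmall : sourceConst N p α * (2 * κ * Γ) ^ p * T ^ (α * (1 - fujitaRatio N p)) ≤ κ * Γ)
    (n : ℕ) {t : ℝ} (ht : t ∈ Ioc 0 T) :
    ∫⁻ x, picard α p (diracMass N κ) n t x ^ p ≤
      ENNReal.ofReal (2 * κ * Γ * t ^ (-(α * decayExponent N p))) ^ p := by
  have hΓ0 : 0 < Γ := hΓ ▸ Real.Gamma_pos_of_pos (sub_pos.2 (decayExponent_lt_one hp hr))
  have := sourceConst_pos h0 h1 hp hr
  induction n generalizing t with
  | zero => simp [picard, zero_lt_one.trans hp]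
  | succ n ih =>
    have ht0 : 0 < t := ht.1
    have hu := measurable_picard (p := p) h0 h1 (diracMass N κ) n
    have hP := lintegral_solutionOpP_diracMass_rpow_le h0 h1 hN hp hr hκ ht0
    rw [← hΓ] at hP
    have hPm : Measurable (solutionOpP α t (diracMass N κ)) :=
      measurable_subordinatedFlow (measurable_wrightDensity h0 h1) _ measurable_const measurable_id
    have hD := lintegral_sourceTerm_rpow_le h0 h1 hN hp hr ht0 (by positivity : 0 < 2 * κ * Γ) hu
      fun s hs => ih ⟨hs.1, hs.2.le.trans ht.2⟩
    have hDm := (measurable_sourceTerm (p := p) h0 h1 hu).of_uncurry_left (x := t)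
    calc ∫⁻ x, picard α p (diracMass N κ) (n + 1) t x ^ p
        ≤ ∫⁻ x, (solutionOpP α t (diracMass N κ) x +
            sourceTerm α p (picard α p (diracMass N κ) n) t x) ^ p := by
          refine lintegral_mono fun x => ?_
          rw [picard, duhamel_eq_solutionOpP_add_sourceTerm]
          gcongr
          exact mul_le_of_le_one_left zero_le (ENNReal.ofReal_le_one.2 h1.le)
      _ ≤ _ := lintegral_add_rpow_le hp.le hPm hDm hP hD
      _ ≤ _ := by
          rw [← ENNReal.ofReal_add (by positivity) (by positivity)]
          gcongr
          have hle : t ^ (α * (1 - fujitaRatio N p)) ≤ T ^ (α * (1 - fujitaRatio N p)) :=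
            Real.rpow_le_rpow ht0.le ht.2 (mul_nonneg h0.le (sub_nonneg.2 hr))
          rw [← add_mul]
          gcongr
          calc _ ≤ κ * Γ + sourceConst N p α * (2 * κ * Γ) ^ p * T ^ (α * (1 - fujitaRatio N p)) :=
                by gcongr
            _ ≤ 2 * κ * Γ := by linarith

lemma picardLimit_lt_top_of_small (h0 : 0 < α) (h1 : α < 1) (hN : 1 ≤ N) (hp : 1 < p)
    (hr : fujitaRatio N p ≤ 1) {κ T Γ : ℝ} (hκ : 0 < κ)
    (hΓ : Γ = Real.Gamma (1 - decayExponent N p))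
    (hsmall : sourceConst N p α * (2 * κ * Γ) ^ p * T ^ (α * (1 - fujitaRatio N p)) ≤ κ * Γ) :
    ∀ᵐ z : ℝ × Space N ∂(volume.restrict (Ioc 0 T ×ˢ univ)),
      picardLimit α p (diracMass N κ) z.1 z.2 < ∞ := by
  have hp0 : 0 < p := by linarith
  have hm := measurable_picardLimit (p := p) h0 h1 (diracMass N κ)
  have hle {t : ℝ} (ht : t ∈ Ioc 0 T) : ∫⁻ x, picardLimit α p (diracMass N κ) t x ^ p ≤
      ENNReal.ofReal (2 * κ * Γ * t ^ (-(α * decayExponent N p))) ^ p := by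
    have hpow (x : Space N) : picardLimit α p (diracMass N κ) t x ^ p =
        ⨆ n, picard α p (diracMass N κ) n t x ^ p := (ENNReal.orderIsoRpow p hp0).map_iSup _
    simp only [hpow]
    rw [lintegral_iSup
      (fun n => (measurable_picard h0 h1 _ n).of_uncurry_left.pow_const p)
      (fun m n hmn x => ENNReal.rpow_le_rpow (monotone_picard hp0.le _ hmn t x) hp0.le)]
    exact iSup_le fun n => lintegral_picard_rpow_le h0 h1 hN hp hr hκ hΓ hsmall n ht
  rw [restrict_Ioc_prod_univ]
  refine (Measure.ae_prod_iff_ae_ae (measurableSet_lt hm measurable_const)).2 ?_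
  filter_upwards [ae_restrict_mem measurableSet_Ioc] with t ht
  have hne : ∫⁻ x, picardLimit α p (diracMass N κ) t x ^ p ≠ ∞ :=
    ne_top_of_le_ne_top (by finiteness) (hle ht)
  filter_upwards [ae_lt_top (hm.of_uncurry_left.pow_const p) hne] with x hx
  exact (ENNReal.rpow_lt_top_iff_of_pos hp0).1 hx

end SmallMass

/-! ### Blow-up of superlinear integral inequalities -/

section Doubling

variable {p A b T : ℝ}

lemma one_sub_two_rpow_pos (hp : 1 < p) : 0 < 1 - (2 : ℝ) ^ (1 - p) :=
  sub_pos.2 (Real.rpow_lt_one_of_one_lt_of_neg one_lt_two (by linarith))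

/-- The time by which a function with `I ≥ (A + b ∫_0^t I) ^ p` exceeds `(2 ^ n * A) ^ p`; on an
interval of length `2 * (2 ^ k * A) ^ (1 - p) / b`, the lower bound `(2 ^ k * A) ^ p` contributes
`2 ^ (k + 1) * A` to `b ∫_0^t I`. -/
noncomputable def doublingTime (p A b : ℝ) (n : ℕ) : ℝ :=
  ∑ k ∈ Finset.range n, 2 * (2 ^ k * A) ^ (1 - p) / b

lemma doublingTime_nonneg (hA : 0 ≤ A) (hb : 0 ≤ b) (n : ℕ) : 0 ≤ doublingTime p A b n :=
  Finset.sum_nonneg fun _ _ => by positivity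

lemma doublingTime_succ (n : ℕ) :
    doublingTime p A b (n + 1) = doublingTime p A b n + 2 * (2 ^ n * A) ^ (1 - p) / b :=
  Finset.sum_range_succ _ _

lemma doublingTime_le (hp : 1 < p) (hA : 0 < A) (hb : 0 < b) (n : ℕ) :
    doublingTime p A b n ≤ 2 / (A ^ (p - 1) * b * (1 - 2 ^ (1 - p))) := by
  have hr := one_sub_two_rpow_pos hp
  have hterm (k : ℕ) : 2 * (2 ^ k * A) ^ (1 - p) / b =
      2 / (A ^ (p - 1) * b) * ((2 : ℝ) ^ (1 - p)) ^ k := by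
    rw [Real.mul_rpow (by positivity) hA.le, ← Real.rpow_natCast_mul zero_le_two,
      mul_comm (k : ℝ), Real.rpow_mul_natCast zero_le_two, ← neg_sub p 1, Real.rpow_neg hA.le]
    field_simp
  have hgeom := (hasSum_geometric_of_lt_one (r := (2 : ℝ) ^ (1 - p)) (by positivity)
    (by linarith)).mul_left (2 / (A ^ (p - 1) * b))
  calc doublingTime p A b n
      = ∑ k ∈ Finset.range n, 2 / (A ^ (p - 1) * b) * ((2 : ℝ) ^ (1 - p)) ^ k :=
        Finset.sum_congr rfl fun k _ => hterm k
    _ ≤ 2 / (A ^ (p - 1) * b) * (1 - 2 ^ (1 - p))⁻¹ :=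
        sum_le_hasSum _ (fun k _ => by positivity) hgeom
    _ = _ := by rw [← div_eq_mul_inv, div_div]

variable {I : ℝ → ℝ≥0∞}

lemma le_of_doublingTime_lt (hp : 0 ≤ p) (hA : 0 < A) (hb : 0 < b)
    (h : ∀ t ∈ Ioc 0 T, (ENNReal.ofReal A + ENNReal.ofReal b * ∫⁻ s in Ioo 0 t, I s) ^ p ≤ I t)
    (n : ℕ) {t : ℝ} (ht : t ∈ Ioc 0 T) (hn : doublingTime p A b n < t) :
    ENNReal.ofReal (2 ^ n * A) ^ p ≤ I t := by
  induction n generalizing t with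
  | zero =>
    refine le_trans ?_ (h t ht)
    gcongr
    simp
  | succ n ih =>
    have hsub : Ioo (doublingTime p A b n) (doublingTime p A b (n + 1)) ⊆ Ioo 0 t :=
      Ioo_subset_Ioo (doublingTime_nonneg hA.le hb.le n) hn.le
    refine le_trans ?_ (h t ht)
    gcongr
    refine le_trans ?_ le_add_self
    calc ENNReal.ofReal (2 ^ (n + 1) * A)
        = ENNReal.ofReal b * (ENNReal.ofReal (2 ^ n * A) ^ p *
            ENNReal.ofReal (2 * (2 ^ n * A) ^ (1 - p) / b)) := by
          rw [ENNReal.ofReal_rpow_of_nonneg (by positivity) hp,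
            ← ENNReal.ofReal_mul (by positivity), ← ENNReal.ofReal_mul hb.le,
            Real.rpow_sub (by positivity), Real.rpow_one]
          congr 1
          field_simp
          ring
      _ = ENNReal.ofReal b * ∫⁻ _ in Ioo (doublingTime p A b n) (doublingTime p A b (n + 1)),
            ENNReal.ofReal (2 ^ n * A) ^ p := by
          rw [setLIntegral_const, Real.volume_Ioo, doublingTime_succ, add_sub_cancel_left]
      _ ≤ ENNReal.ofReal b * ∫⁻ s in Ioo (doublingTime p A b n) (doublingTime p A b (n + 1)),
            I s := by
          gcongr ENNReal.ofReal b * ?_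
          refine setLIntegral_mono' measurableSet_Ioo fun s hs => ?_
          exact ih ⟨(hsub hs).1, (hsub hs).2.le.trans ht.2⟩ hs.1
      _ ≤ _ := by gcongr

lemma eq_top_of_superlinear (hp : 1 < p) (hA : 0 < A) (hb : 0 < b)
    (h : ∀ t ∈ Ioc 0 T, (ENNReal.ofReal A + ENNReal.ofReal b * ∫⁻ s in Ioo 0 t, I s) ^ p ≤ I t)
    (hT : 4 ≤ T * (A ^ (p - 1) * b * (1 - 2 ^ (1 - p)))) {t : ℝ} (ht : t ∈ Ioc (T / 2) T) :
    I t = ∞ := by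
  have hp0 : 0 < p := by linarith
  have hr := one_sub_two_rpow_pos hp
  have hτ (n : ℕ) : doublingTime p A b n < t := by
    refine ((doublingTime_le hp hA hb n).trans ?_).trans_lt ht.1
    rw [div_le_div_iff₀ (by positivity) two_pos]
    linarith
  have ht0 : 0 < t := (doublingTime_nonneg hA.le hb.le 0).trans_lt (hτ 0)
  have hlim : Tendsto (fun n : ℕ => ENNReal.ofReal (2 ^ n * A) ^ p) atTop (𝓝 ∞) := by
    have hpow := (tendsto_pow_atTop_atTop_of_one_lt (one_lt_two (α := ℝ))).atTop_mul_const hA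
    simpa only [ENNReal.top_rpow_of_pos hp0] using
      (ENNReal.tendsto_ofReal_nhds_top.2 hpow).ennrpow_const p
  exact top_le_iff.1 (le_of_tendsto' hlim fun n =>
    le_of_doublingTime_lt hp0.le hA hb h n ⟨ht0, ht.2⟩ (hτ n))

end Doubling

/-! ### Gaussian weighted masses -/

section WeightedMass

variable {N : ℕ} {α p ρ t T : ℝ}

lemma lintegral_mul_mixture {X Z : Type*} [MeasurableSpace X] [MeasurableSpace Z] {μ : Measure X}
    [SFinite μ] {ν : Measure Z} [SFinite ν] {f : X → ℝ≥0∞} (hf : Measurable f) {w : Z → ℝ≥0∞}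
    (hw : Measurable w) {k : Z → X → ℝ≥0∞} (hk : Measurable (Function.uncurry k)) :
    ∫⁻ x, f x * ∫⁻ z, w z * k z x ∂ν ∂μ = ∫⁻ z, w z * ∫⁻ x, f x * k z x ∂μ ∂ν := by
  have : Measurable fun q : X × Z => k q.2 q.1 := hk.comp measurable_swap
  have hx (x : X) : Measurable fun z => k z x := hk.of_uncurry_right
  have hz (z : Z) : Measurable (k z) := hk.of_uncurry_left
  calc _ = ∫⁻ x, ∫⁻ z, f x * (w z * k z x) ∂ν ∂μ :=
        lintegral_congr fun x => (lintegral_const_mul _ (hw.mul (hx x))).symm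
    _ = ∫⁻ z, ∫⁻ x, f x * (w z * k z x) ∂μ ∂ν :=
        lintegral_lintegral_swap (by unfold Function.uncurry; fun_prop)
    _ = _ := by
        refine lintegral_congr fun z => ?_
        simp only [mul_left_comm (f _)]
        exact lintegral_const_mul _ (hf.mul (hz z))

lemma rpow_lintegral_heatKernel_mul_le (hp : 1 < p) (hρ : 0 < ρ) {f : Space N → ℝ≥0∞}
    (hf : Measurable f) :
    (∫⁻ x, ENNReal.ofReal (heatKernel N ρ x) * f x) ^ p ≤
      ∫⁻ x, ENNReal.ofReal (heatKernel N ρ x) * f x ^ p := by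
  have hG (x : Space N) : ENNReal.ofReal (heatKernel N ρ x) ≠ 0 ∧
      ENNReal.ofReal (heatKernel N ρ x) ≠ ∞ :=
    ⟨(ENNReal.ofReal_pos.2 (heatKernel_pos hρ x)).ne', ENNReal.ofReal_ne_top⟩
  have h := rpow_lintegral_le_mul_rpow_lintegral hp (ν := volume)
    (f := fun x : Space N => ENNReal.ofReal (heatKernel N ρ x) * f x) (by fun_prop) (by fun_prop)
    (Eventually.of_forall hG)
  rw [lintegral_heatKernel hρ, ENNReal.one_rpow, mul_one] at h
  refine h.trans_eq (lintegral_congr fun x => ?_)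
  rw [ENNReal.mul_rpow_of_nonneg _ _ (by linarith), mul_right_comm,
    ← ENNReal.rpow_add _ _ (hG x).1 (hG x).2, add_sub_cancel, ENNReal.rpow_one]

lemma lintegral_heatKernel_mul_subordinatedFlow {w : ℝ → ℝ} (hw : Measurable w) (hρ : 0 < ρ)
    (ht : 0 < t) (μ : Measure (Space N)) [SFinite μ] :
    ∫⁻ x, ENNReal.ofReal (heatKernel N ρ x) * subordinatedFlow w α t μ x =
      ∫⁻ θ in Ioi (0 : ℝ), ENNReal.ofReal (w θ) *
        ∫⁻ x, ENNReal.ofReal (heatKernel N (ρ + t ^ α * θ) x) ∂μ := by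
  unfold subordinatedFlow
  rw [lintegral_mul_mixture (by fun_prop) (by fun_prop)
    (measurable_heatFlow μ (by fun_prop) measurable_snd)]
  refine setLIntegral_congr_fun measurableSet_Ioi fun θ (hθ : 0 < θ) => ?_
  rw [lintegral_heatKernel_mul_heatFlow hρ (by positivity)]

/-- The variance parameter of the Gaussian weight for the interval `[0, T]`: comparable to `T ^ α`,
and small enough that the weight is dominated by the heat kernels `G(t ^ α * θ, ·)` with
`T / 4 ≤ t` and `1 / 256 ≤ θ`. -/
noncomputable def testTime (α T : ℝ) : ℝ := T ^ α / 2048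

lemma testTime_pos (hT : 0 < T) : 0 < testTime α T := by
  unfold testTime
  positivity

/-- A lower bound for the fraction of the weighted mass `∫ G(testTime α T, ·) dμ` that is
retained by `P_α(t)` and `S_α(t)` for `t ≤ T`. -/
noncomputable def retentionConst (N : ℕ) : ℝ := 1 / 16384 * (1 / (2048 * 65)) ^ ((N : ℝ) / 2)

lemma retentionConst_pos (N : ℕ) : 0 < retentionConst N := by
  unfold retentionConst
  positivity

lemma mul_heatKernel_testTime_le (h0 : 0 < α) (ht : t ∈ Ioc 0 T) {θ : ℝ}
    (hθ : θ ∈ Icc (1 / 256 : ℝ) 64) (x : Space N) :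
    (1 / (2048 * 65)) ^ ((N : ℝ) / 2) * heatKernel N (testTime α T) x ≤
      heatKernel N (testTime α T + t ^ α * θ) x := by
  have ht0 : 0 < t := ht.1
  have hT : 0 < T := ht0.trans_le ht.2
  have hρ : 0 < testTime α T := testTime_pos hT
  have hθ0 : 0 < θ := by linarith [hθ.1]
  have hle : t ^ α * θ ≤ T ^ α * 64 :=
    mul_le_mul (Real.rpow_le_rpow ht0.le ht.2 h0.le) hθ.2 hθ0.le (by positivity)
  have hσ : 0 ≤ t ^ α * θ := by positivity
  refine le_trans ?_ (mul_heatKernel_le_heatKernel_add hρ hσ x)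
  have := heatKernel_pos hρ x
  gcongr ?_ ^ _ * _
  rw [div_le_div_iff₀ (by norm_num) (by positivity)]
  unfold testTime at hρ ⊢
  linarith

lemma le_lintegral_heatKernel_mul_subordinatedFlow (h0 : 0 < α) {w : ℝ → ℝ} (hw : Measurable w)
    (hmass : ENNReal.ofReal (1 / 16384) ≤ ∫⁻ θ in Icc (1 / 256 : ℝ) 64, ENNReal.ofReal (w θ))
    (ht : t ∈ Ioc 0 T) (μ : Measure (Space N)) [SFinite μ] :
    ENNReal.ofReal (retentionConst N) * ∫⁻ x, ENNReal.ofReal (heatKernel N (testTime α T) x) ∂μ ≤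
      ∫⁻ x, ENNReal.ofReal (heatKernel N (testTime α T) x) * subordinatedFlow w α t μ x := by
  have hρ : 0 < testTime α T := testTime_pos (ht.1.trans_le ht.2)
  have hsub : Icc (1 / 256 : ℝ) 64 ⊆ Ioi 0 := fun θ hθ => mem_Ioi.2 (by linarith [hθ.1])
  set J := ∫⁻ x, ENNReal.ofReal (heatKernel N (testTime α T) x) ∂μ
  set c : ℝ := (1 / (2048 * 65)) ^ ((N : ℝ) / 2)
  have hc : 0 ≤ c := by positivity
  rw [lintegral_heatKernel_mul_subordinatedFlow hw hρ ht.1]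
  calc ENNReal.ofReal (retentionConst N) * J
      = ENNReal.ofReal (1 / 16384) * (ENNReal.ofReal c * J) := by
        rw [retentionConst, ENNReal.ofReal_mul (by norm_num), mul_assoc]
    _ ≤ ∫⁻ θ in Icc (1 / 256 : ℝ) 64, ENNReal.ofReal (w θ) * (ENNReal.ofReal c * J) := by
        rw [lintegral_mul_const _ (by fun_prop)]
        gcongr
    _ ≤ ∫⁻ θ in Icc (1 / 256 : ℝ) 64, ENNReal.ofReal (w θ) *
          ∫⁻ x, ENNReal.ofReal (heatKernel N (testTime α T + t ^ α * θ) x) ∂μ := by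
        refine setLIntegral_mono' measurableSet_Icc fun θ hθ => mul_le_mul_right ?_ _
        rw [← lintegral_const_mul _ (by fun_prop)]
        simp only [← ENNReal.ofReal_mul hc]
        exact lintegral_mono fun x =>
          ENNReal.ofReal_le_ofReal (mul_heatKernel_testTime_le h0 ht hθ x)
    _ ≤ _ := lintegral_mono_set hsub

lemma le_lintegral_id_mul_wrightDensity_Icc (h0 : 0 < α) (h1 : α < 1) :
    ENNReal.ofReal (1 / 16384) ≤
      ∫⁻ θ in Icc (1 / 256 : ℝ) 64, ENNReal.ofReal (θ * wrightDensity α θ) := by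
  have := measurable_wrightDensity h0 h1
  calc ENNReal.ofReal (1 / 16384) = ENNReal.ofReal (1 / 256) * ENNReal.ofReal (1 / 64) := by
        rw [← ENNReal.ofReal_mul (by norm_num)]
        norm_num
    _ ≤ ENNReal.ofReal (1 / 256) *
          ∫⁻ θ in Icc (1 / 256 : ℝ) 64, ENNReal.ofReal (wrightDensity α θ) :=
        mul_le_mul_right (le_lintegral_wrightDensity_Icc h0 h1) _
    _ = ∫⁻ θ in Icc (1 / 256 : ℝ) 64, ENNReal.ofReal (1 / 256 * wrightDensity α θ) := by
        simp only [ENNReal.ofReal_mul (by norm_num : (0 : ℝ) ≤ 1 / 256)]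
        rw [lintegral_const_mul _ (by fun_prop)]
    _ ≤ _ := by
        refine setLIntegral_mono' measurableSet_Icc fun θ hθ => ENNReal.ofReal_le_ofReal ?_
        have hθ0 : 0 < θ := by linarith [hθ.1]
        exact mul_le_mul_of_nonneg_right hθ.1 (wrightDensity_nonneg h0 h1 hθ0)

lemma le_lintegral_heatKernel_mul_solutionOpP (h0 : 0 < α) (h1 : α < 1) (ht : t ∈ Ioc 0 T)
    (μ : Measure (Space N)) [SFinite μ] :
    ENNReal.ofReal (retentionConst N) * ∫⁻ x, ENNReal.ofReal (heatKernel N (testTime α T) x) ∂μ ≤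
      ∫⁻ x, ENNReal.ofReal (heatKernel N (testTime α T) x) * solutionOpP α t μ x :=
  le_lintegral_heatKernel_mul_subordinatedFlow h0 (measurable_wrightDensity h0 h1)
    ((ENNReal.ofReal_le_ofReal (by norm_num)).trans (le_lintegral_wrightDensity_Icc h0 h1)) ht μ

lemma le_lintegral_heatKernel_mul_solutionOpS (h0 : 0 < α) (h1 : α < 1) (ht : t ∈ Ioc 0 T)
    (μ : Measure (Space N)) [SFinite μ] :
    ENNReal.ofReal (retentionConst N) * ∫⁻ x, ENNReal.ofReal (heatKernel N (testTime α T) x) ∂μ ≤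
      ∫⁻ x, ENNReal.ofReal (heatKernel N (testTime α T) x) * solutionOpS α t μ x :=
  have := measurable_wrightDensity h0 h1
  le_lintegral_heatKernel_mul_subordinatedFlow h0 (by fun_prop)
    (le_lintegral_id_mul_wrightDensity_Icc h0 h1) ht μ

lemma two_mul_testTime_le (h0 : 0 ≤ α) (h1 : α ≤ 1) (hT : 0 < T) (ht : T / 4 ≤ t) {θ : ℝ}
    (hθ : 1 / 256 ≤ θ) : 2 * testTime α T ≤ t ^ α * θ := by
  have hle : T ^ α / 4 ≤ t ^ α := by
    calc T ^ α / 4 ≤ T ^ α / 4 ^ α := by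
          gcongr
          exact Real.rpow_le_self_of_one_le (by norm_num) h1
      _ = (T / 4) ^ α := (Real.div_rpow hT.le (by norm_num) α).symm
      _ ≤ t ^ α := Real.rpow_le_rpow (by positivity) ht h0
  calc 2 * testTime α T = T ^ α / 4 * (1 / 256) := by unfold testTime; ring
    _ ≤ t ^ α * θ := mul_le_mul hle hθ (by norm_num) ((by positivity : 0 ≤ T ^ α / 4).trans hle)

lemma heatFlow_eq_top {σ : ℝ} (hρ : 0 < ρ) (hσ : 2 * ρ ≤ σ) {μ : Measure (Space N)}
    (hμ : ∫⁻ x, ENNReal.ofReal (heatKernel N ρ x) ∂μ = ∞) (x : Space N) : heatFlow σ μ x = ∞ := by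
  have hσ0 : 0 < σ := by linarith
  set C : ℝ := (σ / ρ) ^ ((N : ℝ) / 2) * Real.exp (‖x‖ ^ 2 / (2 * σ))
  have hle : ∫⁻ y, ENNReal.ofReal (heatKernel N ρ y) ∂μ ≤ ENNReal.ofReal C * heatFlow σ μ x := by
    rw [heatFlow, ← lintegral_const_mul _ (by fun_prop)]
    simp only [← ENNReal.ofReal_mul (by positivity : 0 ≤ C)]
    exact lintegral_mono fun y =>
      ENNReal.ofReal_le_ofReal (heatKernel_le_mul_heatKernel_sub hρ hσ x y)
  rw [hμ, top_le_iff] at hle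
  by_contra hne
  exact ENNReal.mul_ne_top ENNReal.ofReal_ne_top hne hle

lemma solutionOpS_eq_top (h0 : 0 < α) (h1 : α < 1) (hT : 0 < T) (ht : T / 4 ≤ t)
    {μ : Measure (Space N)} (hμ : ∫⁻ x, ENNReal.ofReal (heatKernel N (testTime α T) x) ∂μ = ∞)
    (x : Space N) : solutionOpS α t μ x = ∞ := by
  have := measurable_wrightDensity h0 h1
  have hsub : Icc (1 / 256 : ℝ) 64 ⊆ Ioi 0 := fun θ hθ => mem_Ioi.2 (by linarith [hθ.1])
  have hpos : ∫⁻ θ in Icc (1 / 256 : ℝ) 64, ENNReal.ofReal (θ * wrightDensity α θ) ≠ 0 :=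
    ((ENNReal.ofReal_pos.2 (by norm_num)).trans_le
      (le_lintegral_id_mul_wrightDensity_Icc h0 h1)).ne'
  refine top_le_iff.1 ?_
  calc ∞ = ∫⁻ θ in Icc (1 / 256 : ℝ) 64, ENNReal.ofReal (θ * wrightDensity α θ) * ∞ := by
        rw [lintegral_mul_const _ (by fun_prop), ENNReal.mul_top hpos]
    _ = ∫⁻ θ in Icc (1 / 256 : ℝ) 64, ENNReal.ofReal (θ * wrightDensity α θ) *
          heatFlow (t ^ α * θ) μ x :=
        setLIntegral_congr_fun measurableSet_Icc fun θ hθ => by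
          rw [heatFlow_eq_top (testTime_pos hT) (two_mul_testTime_le h0.le h1.le hT ht hθ.1) hμ]
    _ ≤ _ := lintegral_mono_set hsub

end WeightedMass

/-! ### A necessary condition for existence -/

section NecessaryCondition

variable {N : ℕ} {α p t T : ℝ}

lemma le_lintegral_heatKernel_mul_sourceTerm (h0 : 0 < α) (h1 : α < 1) (ht : t ∈ Ioc 0 T)
    {u : ℝ → Space N → ℝ≥0∞} (hu : Measurable (Function.uncurry u)) :
    ENNReal.ofReal (T ^ (α - 1) * retentionConst N) *
        ∫⁻ s in Ioo 0 t, ∫⁻ x, ENNReal.ofReal (heatKernel N (testTime α T) x) * u s x ^ p ≤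
      ∫⁻ x, ENNReal.ofReal (heatKernel N (testTime α T) x) * sourceTerm α p u t x := by
  have hT : 0 < T := ht.1.trans_le ht.2
  have hG : Measurable fun x : Space N => ENNReal.ofReal (heatKernel N (testTime α T) x) := by
    fun_prop
  have hJ : Measurable fun s =>
      ∫⁻ x, ENNReal.ofReal (heatKernel N (testTime α T) x) * u s x ^ p :=
    ((hG.comp measurable_snd).mul (hu.pow_const p)).lintegral_prod_right'
  unfold sourceTerm
  rw [lintegral_mul_mixture hG (by fun_prop)
    (measurable_solutionOpS_rpow h0 h1 hu (by fun_prop) measurable_fst measurable_snd),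
    ← lintegral_const_mul _ hJ]
  refine setLIntegral_mono' measurableSet_Ioo fun s hs => ?_
  have hts : 0 < t - s := sub_pos.2 hs.2
  have htsT : t - s ≤ T := by linarith [hs.1, ht.2]
  rw [ENNReal.ofReal_mul (by positivity), mul_assoc]
  refine mul_le_mul' (ENNReal.ofReal_le_ofReal
    (Real.rpow_le_rpow_of_nonpos hts htsT (by linarith))) ?_
  refine le_trans (le_of_eq ?_) (le_lintegral_heatKernel_mul_solutionOpS h0 h1 ⟨hts, htsT⟩
    (volume.withDensity fun y => u s y ^ p))
  rw [lintegral_withDensity_eq_lintegral_mul _ (hu.of_uncurry_left.pow_const p) hG]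
  simp only [Pi.mul_apply, mul_comm]

lemma le_lintegral_heatKernel_mul_duhamel (h0 : 0 < α) (h1 : α < 1) (ht : t ∈ Ioc 0 T)
    (μ : Measure (Space N)) [SFinite μ] {u : ℝ → Space N → ℝ≥0∞}
    (hu : Measurable (Function.uncurry u)) :
    ENNReal.ofReal (retentionConst N) * ∫⁻ x, ENNReal.ofReal (heatKernel N (testTime α T) x) ∂μ +
        ENNReal.ofReal (α * (T ^ (α - 1) * retentionConst N)) *
          ∫⁻ s in Ioo 0 t, ∫⁻ x, ENNReal.ofReal (heatKernel N (testTime α T) x) * u s x ^ p ≤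
      ∫⁻ x, ENNReal.ofReal (heatKernel N (testTime α T) x) * duhamel α p μ u t x := by
  have hPm : Measurable (solutionOpP α t μ) :=
    measurable_subordinatedFlow (measurable_wrightDensity h0 h1) μ measurable_const measurable_id
  have hDm := (measurable_sourceTerm (p := p) h0 h1 hu).of_uncurry_left (x := t)
  simp only [duhamel_eq_solutionOpP_add_sourceTerm, mul_add, mul_left_comm _ (ENNReal.ofReal α)]
  rw [lintegral_add_left (by fun_prop), lintegral_const_mul _ (by fun_prop),
    ENNReal.ofReal_mul h0.le, mul_assoc]
  gcongr
  · exact le_lintegral_heatKernel_mul_solutionOpP h0 h1 ht μ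
  · exact le_lintegral_heatKernel_mul_sourceTerm h0 h1 ht hu

variable {A : ℝ} {μ : Measure (Space N)} [SFinite μ]

lemma lintegral_heatKernel_mul_picardLimit_rpow_eq_top (h0 : 0 < α) (h1 : α < 1) (hp : 1 < p)
    (hA : 0 < A) (hμ : ENNReal.ofReal A ≤ ∫⁻ x, ENNReal.ofReal (heatKernel N (testTime α T) x) ∂μ)
    (hlarge : 4 ≤ T * ((retentionConst N * A) ^ (p - 1) *
      (α * (T ^ (α - 1) * retentionConst N)) * (1 - 2 ^ (1 - p))))
    (ht : t ∈ Ioc (T / 2) T) :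
    ∫⁻ x, ENNReal.ofReal (heatKernel N (testTime α T) x) * picardLimit α p μ t x ^ p = ∞ := by
  have hT : 0 < T := by linarith [ht.1, ht.2]
  have hc := retentionConst_pos N
  have hm := measurable_picardLimit (p := p) h0 h1 μ
  refine eq_top_of_superlinear (I := fun s => ∫⁻ x,
    ENNReal.ofReal (heatKernel N (testTime α T) x) * picardLimit α p μ s x ^ p) hp
    (mul_pos hc hA) (by positivity) (fun s hs => ?_) hlarge ht
  refine le_trans ?_ (rpow_lintegral_heatKernel_mul_le hp (testTime_pos hT) hm.of_uncurry_left)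
  simp only [picardLimit_eq_duhamel h0 h1 (by linarith : 0 < p) μ s]
  gcongr
  refine le_trans ?_ (le_lintegral_heatKernel_mul_duhamel h0 h1 hs μ hm)
  rw [ENNReal.ofReal_mul hc.le]
  gcongr

lemma picardLimit_eq_top (h0 : 0 < α) (h1 : α < 1) (hp : 0 < p) (hT : 0 < T)
    (h : ∀ s ∈ Ioo (T / 2) T, ∫⁻ x,
      ENNReal.ofReal (heatKernel N (testTime α T) x) * picardLimit α p μ s x ^ p = ∞)
    (ht : t ∈ Ioc (7 * T / 8) T) (x : Space N) : picardLimit α p μ t x = ∞ := by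
  have hm := measurable_picardLimit (p := p) h0 h1 μ
  have hS : ∀ s ∈ Ioo (T / 2) (5 * T / 8), ENNReal.ofReal ((t - s) ^ (α - 1)) *
      solutionOpS α (t - s) (volume.withDensity fun y => picardLimit α p μ s y ^ p) x = ∞ := by
    intro s hs
    have hts : T / 4 ≤ t - s := by linarith [ht.1, hs.2]
    have hts0 : 0 < t - s := by linarith
    rw [solutionOpS_eq_top h0 h1 hT hts, ENNReal.mul_top (ENNReal.ofReal_pos.2 (by positivity)).ne']
    rw [lintegral_withDensity_eq_lintegral_mul _ (hm.of_uncurry_left.pow_const p) (by fun_prop)]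
    simpa only [Pi.mul_apply, mul_comm] using h s ⟨hs.1, by linarith [hs.2]⟩
  have hsub : Ioo (T / 2) (5 * T / 8) ⊆ Ioo 0 t :=
    Ioo_subset_Ioo (by linarith) (by linarith [ht.1])
  have hsource : sourceTerm α p (picardLimit α p μ) t x = ∞ := by
    refine top_le_iff.1 (le_trans ?_ (lintegral_mono_set hsub))
    rw [setLIntegral_congr_fun measurableSet_Ioo hS, setLIntegral_const, Real.volume_Ioo,
      ENNReal.top_mul (ENNReal.ofReal_pos.2 (by linarith)).ne']
  rw [picardLimit_eq_duhamel h0 h1 hp, duhamel_eq_solutionOpP_add_sourceTerm, hsource,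
    ENNReal.mul_top (ENNReal.ofReal_pos.2 h0).ne', add_top]

lemma weightedMass_rpow_lt (h0 : 0 < α) (h1 : α < 1) (hp : 1 < p) (hT : 0 < T) (hA : 0 < A)
    (hμ : ENNReal.ofReal A ≤ ∫⁻ x, ENNReal.ofReal (heatKernel N (testTime α T) x) ∂μ)
    (hfin : ∀ᵐ z : ℝ × Space N ∂(volume.restrict (Ioc 0 T ×ˢ univ)),
      picardLimit α p μ z.1 z.2 < ∞) :
    T * ((retentionConst N * A) ^ (p - 1) * (α * (T ^ (α - 1) * retentionConst N)) *
      (1 - 2 ^ (1 - p))) < 4 := by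
  by_contra! hlarge
  have htop {t : ℝ} (ht : t ∈ Ioc (7 * T / 8) T) (x : Space N) : picardLimit α p μ t x = ∞ :=
    picardLimit_eq_top h0 h1 (by linarith) hT (fun s hs =>
      lintegral_heatKernel_mul_picardLimit_rpow_eq_top h0 h1 hp hA hμ hlarge ⟨hs.1, hs.2.le⟩) ht x
  rw [restrict_Ioc_prod_univ] at hfin
  have hslice : ∀ᵐ t ∂(volume.restrict (Ioc (7 * T / 8) T)), ∀ᵐ x : Space N,
      picardLimit α p μ t x < ∞ :=
    ae_restrict_of_ae_restrict_of_subset (Ioc_subset_Ioc_left (by positivity))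
      (Measure.ae_ae_of_ae_prod hfin)
  have : (ae (volume.restrict (Ioc (7 * T / 8) T))).NeBot := by
    rw [ae_neBot, Ne, Measure.restrict_eq_zero, Real.volume_Ioc]
    exact (ENNReal.ofReal_pos.2 (by linarith)).ne'
  obtain ⟨t, hx, ht⟩ := (hslice.and (ae_restrict_mem measurableSet_Ioc)).exists
  obtain ⟨x, hx⟩ := hx.exists
  exact hx.ne (htop ht x)

/-- The constant in the necessary condition for the existence of solutions with initial value
`κ δ_N`. -/
noncomputable def massConst (N : ℕ) (p : ℝ) : ℝ :=
  4 / ((retentionConst N * heatKernel N (1 / 2048) 0) ^ (p - 1) * retentionConst N *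
    (1 - 2 ^ (1 - p)))

lemma massConst_pos (N : ℕ) (hp : 1 < p) : 0 < massConst N p := by
  have := one_sub_two_rpow_pos hp
  have := retentionConst_pos N
  have := heatKernel_pos (by norm_num : (0 : ℝ) < 1 / 2048) (0 : Space N)
  unfold massConst
  positivity

lemma heatKernel_testTime_zero (hT : 0 < T) :
    heatKernel N (testTime α T) 0 = heatKernel N (1 / 2048) 0 * T ^ (-(α * ((N : ℝ) / 2))) := by
  have := Real.pi_pos
  simp only [heatKernel, testTime, norm_zero]
  rw [show 4 * Real.pi * (T ^ α / 2048) = 4 * Real.pi * (1 / 2048) * T ^ α by ring,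
    Real.mul_rpow (by positivity) (by positivity), ← Real.rpow_mul hT.le, Real.rpow_neg hT.le]
  simp
  ring

lemma mass_rpow_lt_of_picardLimit_lt_top (h0 : 0 < α) (h1 : α < 1) (hp : 1 < p) {κ : ℝ}
    (hκ : 0 < κ) (hT : 0 < T)
    (hfin : ∀ᵐ z : ℝ × Space N ∂(volume.restrict (Ioc 0 T ×ˢ univ)),
      picardLimit α p (diracMass N κ) z.1 z.2 < ∞) :
    κ ^ (p - 1) * T ^ (α * (1 - fujitaRatio N p)) < massConst N p / α := by
  have hr := one_sub_two_rpow_pos hp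
  have hc := retentionConst_pos N
  have hg := heatKernel_pos (by norm_num : (0 : ℝ) < 1 / 2048) (0 : Space N)
  have hA : 0 < κ * heatKernel N (testTime α T) 0 :=
    mul_pos hκ (heatKernel_pos (testTime_pos hT) 0)
  have h := weightedMass_rpow_lt h0 h1 hp hT hA (by
    rw [diracMass, lintegral_smul_measure, lintegral_dirac, ENNReal.ofReal_mul hκ.le, smul_eq_mul])
    hfin
  rw [heatKernel_testTime_zero hT] at h
  unfold massConst
  set c := retentionConst N
  set g := heatKernel N (1 / 2048) 0
  rw [div_div, lt_div_iff₀ (by positivity)]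
  refine lt_of_eq_of_lt ?_ h
  have hexp : T ^ (α * (1 - fujitaRatio N p)) =
      T * (T ^ (α - 1) * (T ^ (-(α * ((N : ℝ) / 2)))) ^ (p - 1)) := by
    rw [← Real.rpow_mul hT.le, ← Real.rpow_add hT, mul_comm T, ← Real.rpow_add_one hT.ne',
      fujitaRatio]
    ring_nf
  have hpow (X : ℝ) (hX : 0 < X) : (c * (κ * (g * X))) ^ (p - 1) =
      (c * g) ^ (p - 1) * κ ^ (p - 1) * X ^ (p - 1) := by
    rw [show c * (κ * (g * X)) = c * g * κ * X by ring, Real.mul_rpow (by positivity) hX.le,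
      Real.mul_rpow (by positivity) hκ.le]
  rw [hexp, hpow _ (by positivity)]
  ring

end NecessaryCondition

/-! ### Solvability and life span for a Dirac mass -/

section DiracMass

variable {N : ℕ} {p α κ T : ℝ}

/-- A value of `κ ^ (p - 1) * T ^ (α * (1 - fujitaRatio N p))` up to which the problem with initial
value `κ δ_N` has a solution on `[0, T]`. -/
noncomputable def smallMassConst (N : ℕ) (p α : ℝ) : ℝ :=
  Real.Gamma (1 - decayExponent N p) /
    ((2 * Real.Gamma (1 - decayExponent N p)) ^ p * sourceConst N p α)

lemma isMinimalSolution_of_small (h0 : 0 < α) (h1 : α < 1) (hN : 1 ≤ N) (hp : 1 < p)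
    (hr : fujitaRatio N p ≤ 1) (hκ : 0 < κ)
    (h : κ ^ (p - 1) * T ^ (α * (1 - fujitaRatio N p)) ≤ smallMassConst N p α) :
    IsMinimalSolution α p (diracMass N κ) T (picardLimit α p (diracMass N κ)) := by
  refine isMinimalSolution_picardLimit h0 h1 (by linarith) _
    (picardLimit_lt_top_of_small h0 h1 hN hp hr hκ rfl ?_)
  have hΓ := Real.Gamma_pos_of_pos (sub_pos.2 (decayExponent_lt_one hp hr))
  have hS := sourceConst_pos h0 h1 hp hr
  rw [smallMassConst, le_div_iff₀ (by positivity)] at h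
  set Γ := Real.Gamma (1 - decayExponent N p)
  calc _ = κ * (κ ^ (p - 1) * T ^ (α * (1 - fujitaRatio N p)) *
        ((2 * Γ) ^ p * sourceConst N p α)) := by
        rw [show 2 * κ * Γ = κ * (2 * Γ) by ring, Real.mul_rpow hκ.le (by positivity),
          Real.rpow_sub_one hκ.ne']
        field_simp
    _ ≤ _ := by gcongr

lemma smallMassConst_pos (h0 : 0 < α) (h1 : α < 1) (hp : 1 < p) (hr : fujitaRatio N p ≤ 1) :
    0 < smallMassConst N p α := by
  have := Real.Gamma_pos_of_pos (sub_pos.2 (decayExponent_lt_one hp hr))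
  have := sourceConst_pos h0 h1 hp hr
  unfold smallMassConst
  positivity

lemma diracMass_mono {κ' : ℝ} (h : κ ≤ κ') : diracMass N κ ≤ diracMass N κ' := by
  intro s
  simp only [diracMass, Measure.smul_apply, smul_eq_mul]
  gcongr

lemma LocallySolvable.mono {μ ν : Measure (Space N)} [SFinite μ] (h0 : 0 < α) (h1 : α < 1)
    (hp : 0 < p) (hμν : μ ≤ ν) (h : LocallySolvable α p ν) : LocallySolvable α p μ := by
  obtain ⟨T, hT, u, hu⟩ := h
  exact ⟨T, hT, _,
    (isMinimalSolution_picardLimit h0 h1 hp _ (IsSolution.picardLimit_lt_top hp.le hμν hu)).1⟩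

lemma IsSolution.mass_rpow_lt (h0 : 0 < α) (h1 : α < 1) (hp : 1 < p) (hκ : 0 < κ) {T' : ℝ}
    (hT' : T' ∈ Ioc 0 T) {u : ℝ → Space N → ℝ≥0∞} (hu : IsSolution α p (diracMass N κ) T u) :
    κ ^ (p - 1) * T' ^ (α * (1 - fujitaRatio N p)) < massConst N p / α :=
  mass_rpow_lt_of_picardLimit_lt_top h0 h1 hp hκ hT'.1
    (ae_restrict_of_ae_restrict_of_subset (prod_mono (Ioc_subset_Ioc_right hT'.2) le_rfl)
      (IsSolution.picardLimit_lt_top (by linarith) le_rfl hu))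

lemma rpow_mul_rpow_le_iff {a q c : ℝ} (hκ : 0 < κ) (hT : 0 < T) (ha : 0 < a) (hc : 0 < c) :
    κ ^ q * T ^ a ≤ c ↔ T ≤ c ^ (1 / a) * κ ^ (-(q / a)) := by
  have hX : 0 < c ^ (1 / a) * κ ^ (-(q / a)) := by positivity
  rw [← Real.rpow_le_rpow_iff hT.le hX.le ha, Real.mul_rpow (by positivity) (by positivity),
    ← Real.rpow_mul hc.le, ← Real.rpow_mul hκ.le, one_div_mul_cancel ha.ne', Real.rpow_one,
    show -(q / a) * a = -q by field_simp, Real.rpow_neg hκ.le, ← div_eq_mul_inv,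
    le_div_iff₀ (by positivity), mul_comm]

/-- The solution `T` of `κ ^ (p - 1) * T ^ (α * (1 - fujitaRatio N p)) = c` for the unit mass
`κ = 1`; for general `κ` it is multiplied by `κ ^ (-((p - 1) / (α * (1 - fujitaRatio N p))))`. -/
noncomputable def unitMassTime (N : ℕ) (p α c : ℝ) : ℝ :=
  c ^ (1 / (α * (1 - fujitaRatio N p)))

lemma exists_isMinimalSolution_of_subcritical (h0 : 0 < α) (h1 : α < 1) (hN : 1 ≤ N) (hp : 1 < p)
    (hr : fujitaRatio N p < 1) (hκ : 0 < κ) :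
    ∃ u, IsMinimalSolution α p (diracMass N κ) (unitMassTime N p α (smallMassConst N p α) *
      κ ^ (-((p - 1) / (α * (1 - fujitaRatio N p))))) u := by
  have hc := smallMassConst_pos h0 h1 hp hr.le
  exact ⟨_, isMinimalSolution_of_small h0 h1 hN hp hr.le hκ ((rpow_mul_rpow_le_iff hκ
    (by unfold unitMassTime; positivity) (mul_pos h0 (sub_pos.2 hr)) hc).2 le_rfl)⟩

lemma locallySolvable_of_subcritical (h0 : 0 < α) (h1 : α < 1) (hN : 1 ≤ N) (hp : 1 < p)
    (hr : fujitaRatio N p < 1) (hκ : 0 < κ) : LocallySolvable α p (diracMass N κ) := by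
  have hc := smallMassConst_pos h0 h1 hp hr.le
  obtain ⟨u, hu⟩ := exists_isMinimalSolution_of_subcritical h0 h1 hN hp hr hκ
  exact ⟨_, by unfold unitMassTime; positivity, u, hu.1⟩

lemma le_lifespan (h0 : 0 < α) (h1 : α < 1) (hN : 1 ≤ N) (hp : 1 < p) (hr : fujitaRatio N p < 1)
    (hκ : 0 < κ) :
    ENNReal.ofReal (unitMassTime N p α (smallMassConst N p α) *
      κ ^ (-((p - 1) / (α * (1 - fujitaRatio N p))))) ≤ lifespan α p (diracMass N κ) := by
  have hc := smallMassConst_pos h0 h1 hp hr.le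
  exact le_iSup₂_of_le _ ⟨by unfold unitMassTime; positivity,
    exists_isMinimalSolution_of_subcritical h0 h1 hN hp hr hκ⟩ le_rfl

lemma lifespan_le (h0 : 0 < α) (h1 : α < 1) (hp : 1 < p) (hr : fujitaRatio N p < 1)
    (hκ : 0 < κ) :
    lifespan α p (diracMass N κ) ≤ ENNReal.ofReal (unitMassTime N p α (massConst N p / α) *
      κ ^ (-((p - 1) / (α * (1 - fujitaRatio N p))))) := by
  refine iSup₂_le ?_
  rintro T ⟨hT, u, hu, -⟩
  exact ENNReal.ofReal_le_ofReal ((rpow_mul_rpow_le_iff hκ hT (mul_pos h0 (sub_pos.2 hr))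
    (div_pos (massConst_pos N hp) h0)).1 (hu.mass_rpow_lt h0 h1 hp hκ ⟨hT, le_rfl⟩).le)

lemma limsup_ofReal_mem_Ioo {f : ℝ → ℝ} {a : ℝ} (hf : ContinuousAt f a) (h : 0 < f a) :
    limsup (fun x => ENNReal.ofReal (f x)) (𝓝[<] a) ∈ Ioo 0 ∞ := by
  have hlim : Tendsto (fun x => ENNReal.ofReal (f x)) (𝓝[<] a) (𝓝 (ENNReal.ofReal (f a))) :=
    (ENNReal.tendsto_ofReal hf.tendsto).mono_left nhdsWithin_le_nhds
  rw [hlim.limsup_eq]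
  exact ⟨ENNReal.ofReal_pos.2 h, ENNReal.ofReal_lt_top⟩

lemma continuousAt_unitMassTime (hr : fujitaRatio N p < 1) {c : ℝ → ℝ}
    (hc : ContinuousAt c 1) (hc1 : 0 < c 1) : ContinuousAt (fun α => unitMassTime N p α (c α)) 1 :=
  hc.rpow (continuousAt_const.div (by fun_prop) (by linarith)) (.inl hc1.ne')

lemma continuousAt_smallMassConst_and_pos (hp : 1 < p) (hr : fujitaRatio N p < 1) :
    ContinuousAt (smallMassConst N p) 1 ∧ 0 < smallMassConst N p 1 := by
  have hγ := sub_pos.2 (decayExponent_lt_one hp hr.le)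
  have := sub_pos.2 hr
  have := Real.Gamma_pos_of_pos hγ
  have hpos : 0 < sourceConst N p 1 := by
    simp only [sourceConst, one_mul]
    positivity
  have hcont : ContinuousAt (sourceConst N p) 1 :=
    continuousAt_const.mul ((continuousAt_const.div (by fun_prop) (by linarith)).add
      (continuousAt_const.div (by fun_prop) (by linarith)))
  refine ⟨continuousAt_const.div (continuousAt_const.mul hcont) (by positivity), ?_⟩
  unfold smallMassConst
  positivity

lemma equivalent_lifespan (hN : 1 ≤ N) (hp : 1 < p) (hr : fujitaRatio N p < 1) :
    Equivalent (fun α κ => lifespan α p (diracMass N κ))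
      (fun α κ => κ ^ (-((p - 1) / (α * (1 - fujitaRatio N p))))) := by
  have hM := massConst_pos N hp
  obtain ⟨hs, hs1⟩ := continuousAt_smallMassConst_and_pos hp hr
  have hM1 : 0 < massConst N p / 1 := by simpa using hM
  have hc := continuousAt_unitMassTime hr hs hs1
  have hC := continuousAt_unitMassTime hr (c := fun α => massConst N p / α)
    (continuousAt_const.div continuousAt_id one_ne_zero) hM1
  set c := fun α => unitMassTime N p α (smallMassConst N p α)
  set C := fun α => unitMassTime N p α (massConst N p / α)
  have hc1 : 0 < c 1 := Real.rpow_pos_of_pos hs1 _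
  have hC1 : 0 < C 1 := Real.rpow_pos_of_pos hM1 _
  -- Adding `c` to the upper constant makes `c α < C α + c α` immediate.
  refine ⟨c, fun α => C α + c α, fun α hα => ?_, limsup_ofReal_mem_Ioo hc hc1,
    limsup_ofReal_mem_Ioo (hC.add hc) (add_pos hC1 hc1)⟩
  obtain ⟨h0, h1⟩ := hα
  have hcα : 0 < c α := Real.rpow_pos_of_pos (smallMassConst_pos h0 h1 hp hr.le) _
  have hCα : 0 < C α := Real.rpow_pos_of_pos (div_pos hM h0) _
  refine ⟨hcα, by linarith, fun κ hκ => ⟨le_lifespan h0 h1 hN hp hr hκ, ?_⟩⟩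
  refine (lifespan_le h0 h1 hp hr hκ).trans (ENNReal.ofReal_le_ofReal ?_)
  gcongr
  exact le_add_of_nonneg_right hcα.le

lemma exists_critical_mass (h0 : 0 < α) (h1 : α < 1) (hN : 1 ≤ N) (hp : 1 < p)
    (hr : fujitaRatio N p = 1) : ∃ κ₀ : ℝ, 0 < κ₀ ∧
      (∀ κ : ℝ, 0 < κ → κ < κ₀ → LocallySolvable α p (diracMass N κ)) ∧
      (∀ κ : ℝ, κ₀ < κ → ¬ LocallySolvable α p (diracMass N κ)) := by
  have hc := smallMassConst_pos h0 h1 hp hr.le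
  have hM : 0 < massConst N p / α := div_pos (massConst_pos N hp) h0
  have hp1 : 0 < p - 1 := by linarith
  set S : Set ℝ := {κ | 0 < κ ∧ LocallySolvable α p (diracMass N κ)}
  have hmem : smallMassConst N p α ^ (1 / (p - 1)) ∈ S := by
    refine ⟨by positivity, 1, one_pos, _, (isMinimalSolution_of_small h0 h1 hN hp hr.le
      (by positivity) ?_).1⟩
    rw [Real.one_rpow, mul_one, ← Real.rpow_mul hc.le, one_div_mul_cancel hp1.ne', Real.rpow_one]
  have hbdd : BddAbove S := by
    refine ⟨(massConst N p / α) ^ (1 / (p - 1)), ?_⟩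
    rintro κ ⟨hκ, T, hT, u, hu⟩
    have h := hu.mass_rpow_lt h0 h1 hp hκ ⟨hT, le_rfl⟩
    rw [hr, sub_self, mul_zero, Real.rpow_zero, mul_one] at h
    rw [← Real.rpow_le_rpow_iff hκ.le (by positivity) hp1, ← Real.rpow_mul hM.le,
      one_div_mul_cancel hp1.ne', Real.rpow_one]
    exact h.le
  have hpos : 0 < sSup S := hmem.1.trans_le (le_csSup hbdd hmem)
  refine ⟨sSup S, hpos, fun κ _ hlt => ?_, fun κ hlt hs => ?_⟩
  · obtain ⟨κ', hκ', hlt'⟩ := exists_lt_of_lt_csSup ⟨_, hmem⟩ hlt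
    exact hκ'.2.mono h0 h1 (by linarith) (diracMass_mono hlt'.le)
  · exact hlt.not_ge (le_csSup hbdd ⟨hpos.trans hlt, hs⟩)

lemma not_locallySolvable_of_supercritical (h0 : 0 < α) (h1 : α < 1) (hp : 1 < p)
    (hr : 1 < fujitaRatio N p) (hκ : 0 < κ) : ¬ LocallySolvable α p (diracMass N κ) := by
  rintro ⟨T, hT, u, hu⟩
  have hneg : α * (1 - fujitaRatio N p) < 0 := mul_neg_of_pos_of_neg h0 (by linarith)
  have hlim : Tendsto (fun T' : ℝ => κ ^ (p - 1) * T' ^ (α * (1 - fujitaRatio N p)))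
      (𝓝[>] 0) atTop :=
    (tendsto_rpow_neg_nhdsGT_zero hneg).const_mul_atTop (by positivity)
  obtain ⟨T', h, hT'⟩ := ((hlim.eventually_ge_atTop (massConst N p / α)).and
    (Ioc_mem_nhdsGT hT)).exists
  exact h.not_gt (hu.mass_rpow_lt h0 h1 hp hκ hT')

lemma fujitaRatio_lt_one_iff (hN : 1 ≤ N) : fujitaRatio N p < 1 ↔ p < fujitaExponent N := by
  have : (0 : ℝ) < N := by exact_mod_cast hN
  rw [fujitaRatio, fujitaExponent, div_lt_one two_pos, ← sub_lt_iff_lt_add', lt_div_iff₀' this]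

lemma one_lt_fujitaRatio_iff (hN : 1 ≤ N) : 1 < fujitaRatio N p ↔ fujitaExponent N < p := by
  have : (0 : ℝ) < N := by exact_mod_cast hN
  rw [fujitaRatio, fujitaExponent, one_lt_div two_pos, ← lt_sub_iff_add_lt', div_lt_iff₀' this]

lemma fujitaRatio_fujitaExponent (hN : 1 ≤ N) : fujitaRatio N (fujitaExponent N) = 1 := by
  have : (0 : ℝ) < N := by exact_mod_cast hN
  rw [fujitaRatio, fujitaExponent]
  field_simp
  ring

lemma lifespanExponent_eq :
    2 * (p - 1) / (α * (2 - N * (p - 1))) = (p - 1) / (α * (1 - fujitaRatio N p)) := by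
  rw [fujitaRatio, show α * (2 - N * (p - 1)) = 2 * (α * (1 - N * (p - 1) / 2)) by ring,
    mul_div_mul_left _ _ two_ne_zero]

end DiracMass

end TimeFractionalFujita

open TimeFractionalFujita in
theorem corollary1p1 (N : ℕ) (hN : 1 ≤ N) (p : ℝ) (hp : 1 < p) :
    (p < fujitaExponent N →
      (∀ α ∈ Set.Ioo (0 : ℝ) 1, ∀ κ : ℝ, 0 < κ → LocallySolvable α p (diracMass N κ)) ∧
      Equivalent (fun α κ => lifespan α p (diracMass N κ))
        (fun α κ => κ ^ (-(2 * (p - 1) / (α * (2 - (N : ℝ) * (p - 1))))))) ∧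
    (p = fujitaExponent N → ∀ α ∈ Set.Ioo (0 : ℝ) 1, ∃ κ₀ : ℝ, 0 < κ₀ ∧
      (∀ κ : ℝ, 0 < κ → κ < κ₀ → LocallySolvable α p (diracMass N κ)) ∧
      (∀ κ : ℝ, κ₀ < κ → ¬ LocallySolvable α p (diracMass N κ))) ∧
    (fujitaExponent N < p → ∀ α ∈ Set.Ioo (0 : ℝ) 1, ∀ κ : ℝ, 0 < κ →
      ¬ LocallySolvable α p (diracMass N κ)) := by
  refine ⟨fun h => ?_, fun h α hα => ?_, fun h α hα κ hκ => ?_⟩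
  · have hr := (fujitaRatio_lt_one_iff hN).2 h
    simp only [lifespanExponent_eq]
    exact ⟨fun α hα κ hκ => locallySolvable_of_subcritical hα.1 hα.2 hN hp hr hκ,
      equivalent_lifespan hN hp hr⟩
  · exact exists_critical_mass hα.1 hα.2 hN hp (h ▸ fujitaRatio_fujitaExponent hN)
  · exact not_locallySolvable_of_supercritical hα.1 hα.2 hp ((one_lt_fujitaRatio_iff hN).2 h) hκ
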